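/- Let $d\ge 2$, $\rho>0$, let $\mathfrak S^{d-1}$ be the unit sphere of $\mathbb R^d$ and $\psi_d$ the uniform distribution on it. For $\xi\in\mathbb R^d$ and $v\in\mathfrak S^{d-1}$ put $\lambda(\xi,v)=\langle\xi,v\rangle^+$ and $\kappa(\xi,v)=v-2\frac{\langle\xi,v\rangle}{\|\xi\|^2}\xi$ (with $\kappa(0,v)=v$). Let $x_t=(\xi_t,v_t)_{t\ge0}$ be the Bouncy Particle Sampler on $\mathbb R^d\times\mathfrak S^{d-1}$ with target $\mathcal N(0,I_d)$ and refreshment rate $\rho$, that is, an adapted process with càdlàg velocity such that almost surely, for all $t\ge0$, $$\xi_t=\xi_0+\int_0^t v_s\,\mathrm ds,$$ $$v_t=v_0+\int_{[0,t]\times\mathbb R_+}(\kappa(x_{s-})-v_{s-})\,1_{\{z\le\lambda(x_{s-})\}}\,N(\mathrm ds,\mathrm dz)+\int_{[0,t]\times\mathfrak S^{d-1}}(u-v_{s-})\,R(\mathrm ds,\mathrm du),$$ where, relative to the underlying filtration, $N$ and $R$ are independent Poisson random measures on $\mathbb R_+\times\mathbb R_+$ and $\mathbb R_+\times\mathfrak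 S^{d-1}$ with intensity measures $\mathrm ds\,\mathrm dz$ and $\rho\,\mathrm ds\,\psi_d(\mathrm du)$ (both are adapted, and their points after any time $t$ are jointly independent of the information available at time $t$). Assume that $(x_t)_{t\ge0}$ is strictly stationary with one-time law $\mathcal N(0,I_d)\otimes\psi_d$. Let $S_t=\langle\xi_t,v_t\rangle$ be the angular momentum process and $\Delta S_t=S_t-S_{t-}$ (with $S_{0-}=S_0$). Then for every $T\ge0$ the number of switches $\sum_{0\le t\le T}1_{\{\Delta S_t\ne0\}}$ agrees almost surely with a random variable, and its expectation does not depend on $d$: $$\mathbb E\Big[\sum_{0\le t\le T}1_{\{\Delta S_t\neq0\}}\Big]=T\Big(\frac1{\sqrt{2\pi}}+\rho\Big).$$ -/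

import Mathlib

open MeasureTheory ProbabilityTheory Filter Set
open scoped NNReal ENNReal

noncomputable section

/-- Lebesgue measure on `ℝ₊ = [0, ∞)`. -/
def lebesgueNN : Measure ℝ≥0 := Measure.comap ((↑) : ℝ≥0 → ℝ) volume

/-- Euclidean space `ℝ^d`. -/
abbrev Euc (d : ℕ) : Type := EuclideanSpace ℝ (Fin d)

/-- The unit sphere of `ℝ^d`, the set of possible velocities. -/
abbrev USphere (d : ℕ) : Type := Metric.sphere (0 : Euc d) 1

/-- The uniform probability measure on the unit sphere of `ℝ^d`: the surface measure,
normalised to total mass one. -/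
def sphereUniform (d : ℕ) : Measure (USphere d) :=
  ((volume : Measure (Euc d)).toSphere univ)⁻¹ • (volume : Measure (Euc d)).toSphere

/-- The invariant law of the sampler for the target `N(0, I_d)`: the position is standard normal
and the velocity is independent of it and uniform on the unit sphere. -/
def bpsTarget (d : ℕ) : Measure (Euc d × USphere d) :=
  (stdGaussian (Euc d)).prod (sphereUniform d)

/-- A point measure: a countable sum of unit point masses (repetitions are allowed). -/
def IsPointMeasure {X : Type*} [MeasurableSpace X] (m : Measure X) : Prop :=
  ∃ (I : Set ℕ) (x : ℕ → X), m = Measure.sum (fun i : I => Measure.dirac (x i))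

/-- `N` is a Poisson random measure on `X` with intensity measure `μ`: it is a random point
measure, `N(A)` has the Poisson law with mean `μ(A)` whenever `μ(A) < ∞`, and the values of `N`
on disjoint sets are independent. -/
structure IsPoissonRandomMeasure {Ω X : Type*} [MeasurableSpace Ω] [MeasurableSpace X]
    (P : Measure Ω) (N : Ω → Measure X) (μ : Measure X) : Prop where
  measurable : Measurable N
  isPointMeasure : ∀ᵐ ω ∂P, IsPointMeasure (N ω)
  law : ∀ A : Set X, MeasurableSet A → μ A ≠ ∞ →
    P.map (fun ω => N ω A) = (poissonMeasure (μ A).toNNReal).map (fun n : ℕ => (n : ℝ≥0∞))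
  indep : ∀ (n : ℕ) (A : Fin n → Set X), (∀ i, MeasurableSet (A i)) →
    Pairwise (fun i j => Disjoint (A i) (A j)) → iIndepFun (fun i ω => N ω (A i)) P

/-- The random measure `N` on `ℝ₊ × Y` is adapted to the filtration `F`: the values of `N` on
subsets of `[0, t] × Y` are known at time `t`. -/
def NoiseAdapted {Ω Y : Type*} [MeasurableSpace Y] {mΩ : MeasurableSpace Ω}
    (F : Filtration ℝ≥0 mΩ) (N : Ω → Measure (ℝ≥0 × Y)) : Prop :=
  ∀ (t : ℝ≥0) (A : Set (ℝ≥0 × Y)), MeasurableSet A → A ⊆ Iic t ×ˢ univ →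
    Measurable[F t] (fun ω => N ω A)

/-- The `σ`-algebra generated by the random measure `N` after time `t`, that is, by its
restriction to `(t, ∞) × Y`. -/
abbrev futureNoise {Ω Y : Type*} [MeasurableSpace Y]
    (N : Ω → Measure (ℝ≥0 × Y)) (t : ℝ≥0) : MeasurableSpace Ω :=
  MeasurableSpace.comap (fun ω => (N ω).restrict (Ioi t ×ˢ univ)) inferInstance

/-- The bounce rate `⟨ξ, v⟩⁺` of the sampler for the potential `‖ξ‖² / 2`. -/
def bounceRate {d : ℕ} (ξ v : Euc d) : ℝ := max (inner ℝ ξ v) 0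

/-- The reflection of the velocity `v` at the gradient `ξ` of the potential `‖ξ‖² / 2`. At `ξ = 0`,
where the bounce rate vanishes, it is `v`. -/
def bounce {d : ℕ} (ξ v : Euc d) : Euc d := v - (2 * inner ℝ ξ v / ‖ξ‖ ^ 2) • ξ

/-- The change of velocity `(κ(x_{s-}) - v_{s-}) 1{z ≤ λ(x_{s-})}` caused by a point `(s, z)` of the
Poisson measure that drives the bounces, along a path `(ξ, v)`. -/
def bounceJump {d : ℕ} (ξ : ℝ≥0 → Euc d) (v : ℝ≥0 → USphere d) (s z : ℝ≥0) : Euc d :=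
  let ξl : Euc d := Function.leftLim ξ s
  let vl : USphere d := Function.leftLim v s
  if (z : ℝ) ≤ bounceRate ξl (vl : Euc d) then bounce ξl (vl : Euc d) - (vl : Euc d) else 0

/-- `(ξ, v)` is a Bouncy Particle Sampler in dimension `d` with target `N(0, I_d)` and refreshment
rate `ρ`: a càdlàg solution, adapted to the filtration `F`, of the stochastic equations
`ξ_t = ξ_0 + ∫_0^t v_s ds` and
`v_t = v_0 + ∫_{[0,t] × ℝ₊} (κ(x_{s-}) - v_{s-}) 1{z ≤ λ(x_{s-})} N(ds, dz)
+ ∫_{[0,t] × sphere} (u - v_{s-}) R(ds, du)`,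
where `N` and `R` are independent Poisson random measures with intensities `ds dz` and
`ρ ds ψ(du)`, `ψ` being the uniform law on the sphere, whose points after any time `t` are
independent of the information at time `t`. -/
structure IsBPS {Ω : Type*} {mΩ : MeasurableSpace Ω} (P : Measure Ω) (d : ℕ) (ρ : ℝ≥0)
    (F : Filtration ℝ≥0 mΩ) (N : Ω → Measure (ℝ≥0 × ℝ≥0)) (R : Ω → Measure (ℝ≥0 × USphere d))
    (ξ : ℝ≥0 → Ω → Euc d) (v : ℝ≥0 → Ω → USphere d) : Prop where
  poisson_bounce : IsPoissonRandomMeasure P N (lebesgueNN.prod lebesgueNN)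
  poisson_refresh : IsPoissonRandomMeasure P R
    (lebesgueNN.prod ((ρ : ℝ≥0∞) • sphereUniform d))
  indep_noise : IndepFun N R P
  adapted_bounce : NoiseAdapted F N
  adapted_refresh : NoiseAdapted F R
  indep_future : ∀ t : ℝ≥0, Indep (F t) (futureNoise N t ⊔ futureNoise R t) P
  adapted_pos : Adapted F ξ
  adapted_vel : Adapted F v
  right_cont : ∀ ω t, ContinuousWithinAt (fun s => v s ω) (Ici t) t
  left_lim : ∀ ω t, ∃ l, Tendsto (fun s => v s ω) (nhdsWithin t (Iio t)) (nhds l)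
  pos_eq : ∀ᵐ ω ∂P, ∀ t : ℝ≥0, ξ t ω = ξ 0 ω + ∫ s in Icc 0 t, (v s ω : Euc d) ∂lebesgueNN
  vel_eq : ∀ᵐ ω ∂P, ∀ t : ℝ≥0, (v t ω : Euc d) = (v 0 ω : Euc d)
    + (∫ p in Icc 0 t ×ˢ univ, bounceJump (fun s => ξ s ω) (fun s => v s ω) p.1 p.2 ∂(N ω))
    + ∫ p in Icc 0 t ×ˢ univ,
        ((p.2 : Euc d) - ((Function.leftLim (fun s => v s ω) p.1 : USphere d) : Euc d)) ∂(R ω)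

/-- The process `(ξ, v)` is (strictly) stationary with one-time law `N(0, I_d) ⊗ ψ`: at time `0` it
has this law, and shifting time does not change the law of the whole process. -/
structure IsStationaryFromTarget {Ω : Type*} [MeasurableSpace Ω] (P : Measure Ω) {d : ℕ}
    (ξ : ℝ≥0 → Ω → Euc d) (v : ℝ≥0 → Ω → USphere d) : Prop where
  initial_law : P.map (fun ω => (ξ 0 ω, v 0 ω)) = bpsTarget d
  shift_law : ∀ h : ℝ≥0, IdentDistrib
    (fun ω (t : ℝ≥0) => (ξ (t + h) ω, v (t + h) ω)) (fun ω (t : ℝ≥0) => (ξ t ω, v t ω)) P P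

/-- The angular momentum process `S_t = ⟨ξ_t, v_t⟩`. -/
def angularMomentum {Ω : Type*} {d : ℕ} (ξ : ℝ≥0 → Ω → Euc d) (v : ℝ≥0 → Ω → USphere d)
    (t : ℝ≥0) (ω : Ω) : ℝ := inner ℝ (ξ t ω) (v t ω : Euc d)

/-- The number (possibly infinite) of times `t ∈ [0, T]` at which the path `S` jumps, that is, at
which `S_t ≠ S_{t-}`; by convention `S_{0-} = S_0`. -/
def numSwitches (S : ℝ≥0 → ℝ) (T : ℝ≥0) : ℝ≥0∞ :=
  (({t : ℝ≥0 | t ≤ T ∧ S t - Function.leftLim S t ≠ 0}.encard : ℕ∞) : ℝ≥0∞)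

end

/-! The velocity has norm one, so the position is Lipschitz and `S` can jump only through the
velocity. A point of `N` at time t with mark z ≤ λ(x_{t-}) makes `S` jump by -2⟨ξ_t, v_{t-}⟩. This
is nonzero: otherwise the rate vanishes and z = 0, and almost surely no mark is 0. A point (t, u) of
`R` makes it jump by ⟨ξ_t, u - v_{t-}⟩. Almost surely no two points of the noises within bounded
marks share a time, and the rate is bounded on [0, T], so jumps cannot cancel. Hence the number of
switches is the number of points of `N` under the graph of s ↦ λ(x_{s-}) plus the number of points
of `R`, both over (0, T] (`RegularPath.numSwitches_eq`, `ae_no_simultaneous_points`).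

The second count has mean ρT. For the first, left limits are predictable, so Campbell's formula
(`campbell`) gives ∫_0^T E λ(x_{s-}) ds. By stationarity and passage to the limit, x_{s-} has the
target law (`map_leftVersion`). Under it ⟨ξ, v⟩ is standard normal given v, because ‖v‖ = 1, and the
mean of its positive part is 1/√(2π) in every dimension (`lintegral_bounceRate_bpsTarget`).

That refreshments really change `S` is again Campbell's formula, now for `R`: the expected number of
ineffective ones is zero, since for u ≠ v the variable ⟨ξ, u - v⟩ is a nondegenerate Gaussian and
the uniform law on the sphere has no atoms (`lintegral_refresh_null`). -/

/-! ### Lebesgue measure on the half-line -/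

theorem measurableEmbedding_coe_nnreal : MeasurableEmbedding ((↑) : ℝ≥0 → ℝ) :=
  MeasurableEmbedding.subtype_coe measurableSet_Ici

theorem lebesgueNN_apply (s : Set ℝ≥0) : lebesgueNN s = volume ((↑) '' s : Set ℝ) :=
  measurableEmbedding_coe_nnreal.comap_apply _ _

theorem lebesgueNN_Ioc (a b : ℝ≥0) : lebesgueNN (Ioc a b) = ENNReal.ofReal (b - a) := by
  rw [lebesgueNN_apply]
  have : ((↑) '' Ioc a b : Set ℝ) = Ioc (a : ℝ) b := by
    ext x
    constructor
    · rintro ⟨y, hy, rfl⟩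
      exact ⟨by exact_mod_cast hy.1, by exact_mod_cast hy.2⟩
    · intro hx
      exact ⟨⟨x, a.2.trans hx.1.le⟩, ⟨hx.1, hx.2⟩, rfl⟩
  rw [this, Real.volume_Ioc]

theorem lebesgueNN_singleton (t : ℝ≥0) : lebesgueNN {t} = 0 := by
  simp [lebesgueNN_apply]

theorem lebesgueNN_Icc_zero (b : ℝ≥0) : lebesgueNN (Icc 0 b) = b := by
  rw [← Ioc_insert_left (zero_le (a := b)), insert_eq]
  apply le_antisymm
  · refine (measure_union_le _ _).trans ?_
    rw [lebesgueNN_singleton, lebesgueNN_Ioc]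
    simp
  · refine le_trans ?_ (measure_mono subset_union_right)
    rw [lebesgueNN_Ioc]
    simp

instance : SigmaFinite lebesgueNN := by
  have h : SigmaFinite (lebesgueNN.map ((↑) : ℝ≥0 → ℝ)) := by
    rw [lebesgueNN, measurableEmbedding_coe_nnreal.map_comap]
    infer_instance
  exact SigmaFinite.of_map _ measurableEmbedding_coe_nnreal.measurable.aemeasurable h

/-! ### Moments and tail bounds of Poisson random measures -/

section Poisson

theorem lintegral_natCast_poissonMeasure (r : ℝ≥0) :
    ∫⁻ n : ℕ, (n : ℝ≥0∞) ∂(poissonMeasure r) = r := by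
  have hs : HasSum (fun n : ℕ => Real.exp (-r) * (r : ℝ) ^ n / n.factorial * n) r := by
    -- The term n = 0 vanishes; the shifted series is r times the total mass, since (n + 1)/(n + 1)!
    -- = 1/n!.
    rw [← hasSum_nat_add_iff' 1]
    simp only [Finset.range_one, Finset.sum_singleton, Nat.cast_zero, mul_zero, sub_zero]
    have h := (hasSum_one_poissonMeasure r).mul_right (r : ℝ)
    rw [one_mul] at h
    refine h.congr_fun fun n => ?_
    rw [Nat.factorial_succ]
    push_cast
    field_simp
    ring
  rw [poissonMeasure, lintegral_sum_measure]
  simp only [lintegral_smul_measure, lintegral_dirac, smul_eq_mul]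
  have : ∀ n : ℕ, ENNReal.ofReal (Real.exp (-r) * (r : ℝ) ^ n / n.factorial) * (n : ℝ≥0∞)
      = ENNReal.ofReal (Real.exp (-r) * (r : ℝ) ^ n / n.factorial * n) := by
    intro n
    rw [ENNReal.ofReal_mul (by positivity), ENNReal.ofReal_natCast]
  simp_rw [this]
  rw [← ENNReal.ofReal_tsum_of_nonneg (fun n => by positivity) hs.summable, hs.tsum_eq,
    ENNReal.ofReal_coe_nnreal]

/-- Since exp(-r) ≥ 1 - r, one has 1 - (1 + r) exp(-r) ≤ 1 - (1 + r)(1 - r) = r². The quadratic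
order is what makes a union bound over short time strips vanish. -/
theorem poissonMeasure_one_lt_le (r : ℝ≥0) :
    poissonMeasure r {n : ℕ | 1 < n} ≤ (r : ℝ≥0∞) ^ 2 := by
  have hc : {n : ℕ | 1 < n} = ({0, 1} : Set ℕ)ᶜ := by
    ext n
    simp only [mem_ofPred_eq, mem_compl_iff, mem_insert_iff, mem_singleton_iff]
    omega
  have h1 : (poissonMeasure r).real {n : ℕ | 1 < n} ≤ (r : ℝ) ^ 2 := by
    rw [hc, probReal_compl_eq_one_sub (by measurability), insert_eq,
      measureReal_union (by simp) (by measurability), poissonMeasure_real_singleton,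
      poissonMeasure_real_singleton]
    have h2 : 1 - (r : ℝ) ≤ Real.exp (-r) := by
      have := Real.add_one_le_exp (-(r : ℝ))
      linarith
    have h3 : (0 : ℝ) ≤ r := r.2
    simp
    nlinarith
  rw [← ENNReal.ofReal_toReal (measure_ne_top (poissonMeasure r) _)]
  refine (ENNReal.ofReal_le_ofReal h1).trans ?_
  rw [ENNReal.ofReal_pow (NNReal.coe_nonneg r), ENNReal.ofReal_coe_nnreal]

variable {Ω X : Type*} [MeasurableSpace Ω] [MeasurableSpace X] {P : Measure Ω}
  {N : Ω → Measure X} {μ : Measure X}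

theorem IsPoissonRandomMeasure.measurable_apply (hN : IsPoissonRandomMeasure P N μ)
    {A : Set X} (hA : MeasurableSet A) : Measurable (fun ω => N ω A) :=
  (Measure.measurable_coe hA).comp hN.measurable

theorem IsPoissonRandomMeasure.lintegral_apply (hN : IsPoissonRandomMeasure P N μ)
    {A : Set X} (hA : MeasurableSet A) (hμ : μ A ≠ ∞) : ∫⁻ ω, N ω A ∂P = μ A := by
  have h : ∫⁻ x, x ∂(P.map (fun ω => N ω A)) = μ A := by
    rw [hN.law A hA hμ, lintegral_map (f := fun x => x) measurable_id (by fun_prop),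
      lintegral_natCast_poissonMeasure, ENNReal.coe_toNNReal hμ]
  rwa [lintegral_map (f := fun x => x) measurable_id (hN.measurable_apply hA)] at h

theorem IsPoissonRandomMeasure.ae_ne_top (hN : IsPoissonRandomMeasure P N μ)
    {A : Set X} (hA : MeasurableSet A) (hμ : μ A ≠ ∞) : ∀ᵐ ω ∂P, N ω A ≠ ∞ := by
  have h := ae_lt_top (hN.measurable_apply hA) (by rwa [hN.lintegral_apply hA hμ])
  filter_upwards [h] with ω hω using hω.ne

theorem IsPoissonRandomMeasure.ae_eq_zero (hN : IsPoissonRandomMeasure P N μ)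
    {A : Set X} (hA : MeasurableSet A) (hμ : μ A = 0) : ∀ᵐ ω ∂P, N ω A = 0 := by
  have h := hN.lintegral_apply hA (by simp [hμ])
  rw [hμ] at h
  exact (lintegral_eq_zero_iff (hN.measurable_apply hA)).1 h

theorem IsPoissonRandomMeasure.measure_one_lt_le (hN : IsPoissonRandomMeasure P N μ)
    {A : Set X} (hA : MeasurableSet A) (hμ : μ A ≠ ∞) :
    P {ω | 1 < N ω A} ≤ μ A ^ 2 := by
  have h : P {ω | 1 < N ω A} = P.map (fun ω => N ω A) (Ioi 1) := by
    rw [Measure.map_apply (hN.measurable_apply hA) measurableSet_Ioi]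
    rfl
  rw [h, hN.law A hA hμ, Measure.map_apply (by fun_prop) measurableSet_Ioi]
  have : (fun n : ℕ => (n : ℝ≥0∞)) ⁻¹' Ioi 1 = {n : ℕ | 1 < n} := by
    ext n
    simp
  rw [this]
  refine (poissonMeasure_one_lt_le _).trans ?_
  rw [ENNReal.coe_toNNReal hμ]

/-- The law of `N A` is carried by the integers, so being nonzero amounts to being at least one, and
Markov's inequality applies. -/
theorem IsPoissonRandomMeasure.measure_ne_zero_le (hN : IsPoissonRandomMeasure P N μ)
    {A : Set X} (hA : MeasurableSet A) (hμ : μ A ≠ ∞) :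
    P {ω | N ω A ≠ 0} ≤ μ A := by
  have h : P {ω | N ω A ≠ 0} = P.map (fun ω => N ω A) {0}ᶜ := by
    rw [Measure.map_apply (hN.measurable_apply hA) (measurableSet_singleton 0).compl]
    rfl
  have h2 : P {ω | N ω A ≠ 0} = P {ω | 1 ≤ N ω A} := by
    have h3 : P {ω | 1 ≤ N ω A} = P.map (fun ω => N ω A) (Ici 1) := by
      rw [Measure.map_apply (hN.measurable_apply hA) measurableSet_Ici]
      rfl
    rw [h, h3, hN.law A hA hμ, Measure.map_apply (by fun_prop) measurableSet_Ici,
      Measure.map_apply (by fun_prop) (measurableSet_singleton 0).compl]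
    congr 1
    ext n
    simp [Nat.one_le_iff_ne_zero]
  rw [h2, ← hN.lintegral_apply hA hμ]
  simpa using mul_meas_ge_le_lintegral (μ := P) (hN.measurable_apply hA) 1

end Poisson

/-! ### Campbell's formula for predictable sets -/

section Campbell

variable {Ω Y : Type*} {mΩ : MeasurableSpace Ω} [mY : MeasurableSpace Y]

/-- The product of the predictable `σ`-algebra of `F` with the `σ`-algebra of the mark space. -/
abbrev predictableMarked (F : Filtration ℝ≥0 mΩ) (Y : Type*) [mY : MeasurableSpace Y] :
    MeasurableSpace ((ℝ≥0 × Ω) × Y) :=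
  F.predictable.prod mY

/-- The section at `ω` of a set of triples (time, `ω`, mark). -/
def pathSection (C : Set ((ℝ≥0 × Ω) × Y)) (ω : Ω) : Set (ℝ≥0 × Y) :=
  {x | ((x.1, ω), x.2) ∈ C}

theorem predictable_le_prod (F : Filtration ℝ≥0 mΩ) :
    F.predictable ≤ (inferInstance : MeasurableSpace (ℝ≥0 × Ω)) :=
  measurableSpace_le_predictable_of_measurableSet
    (fun _ hA => (measurableSet_singleton _).prod (F.le _ _ hA))
    (fun _ _ hA => measurableSet_Ioi.prod (F.le _ _ hA))

theorem predictableMarked_le (F : Filtration ℝ≥0 mΩ) :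
    predictableMarked F Y ≤ (inferInstance : MeasurableSpace ((ℝ≥0 × Ω) × Y)) :=
  sup_le_sup (MeasurableSpace.comap_mono (predictable_le_prod F)) le_rfl

theorem futureNoise_le {N : Ω → Measure (ℝ≥0 × Y)} (hN : Measurable N) (t : ℝ≥0) :
    futureNoise N t ≤ mΩ := by
  have h : Measurable fun ω => (N ω).restrict (Ioi t ×ˢ univ) := by
    refine Measure.measurable_of_measurable_coe _ fun s hs => ?_
    simp_rw [Measure.restrict_apply hs]
    exact (Measure.measurable_coe (hs.inter (measurableSet_Ioi.prod MeasurableSet.univ))).comp hN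
  exact h.comap_le

theorem measurableSet_pathSection {C : Set ((ℝ≥0 × Ω) × Y)} (hC : MeasurableSet C) (ω : Ω) :
    MeasurableSet (pathSection C ω) := by
  have : Measurable (fun x : ℝ≥0 × Y => ((x.1, ω), x.2)) := by fun_prop
  exact this hC

/-- The generating sets of the predictable `σ`-algebra. -/
def predictableGenerators (F : Filtration ℝ≥0 mΩ) : Set (Set (ℝ≥0 × Ω)) :=
  {s | ∃ A, MeasurableSet[F ⊥] A ∧ s = {⊥} ×ˢ A} ∪
    {s | ∃ i A, MeasurableSet[F i] A ∧ s = Ioi i ×ˢ A}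

theorem isPiSystem_predictableGenerators (F : Filtration ℝ≥0 mΩ) :
    IsPiSystem (predictableGenerators F) := by
  rintro _ (⟨A, hA, rfl⟩ | ⟨i, A, hA, rfl⟩) _ (⟨B, hB, rfl⟩ | ⟨j, B, hB, rfl⟩) hne
  · left
    exact ⟨A ∩ B, hA.inter hB, by rw [prod_inter_prod, inter_self]⟩
  · obtain ⟨⟨x, y⟩, hx, hx'⟩ := hne
    simp only [mem_prod, mem_singleton_iff, mem_Ioi] at hx hx'
    simp [hx.1] at hx'
  · obtain ⟨⟨x, y⟩, hx, hx'⟩ := hne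
    simp only [mem_prod, mem_singleton_iff, mem_Ioi] at hx hx'
    simp [hx'.1] at hx
  · right
    exact ⟨i ⊔ j, A ∩ B, (F.mono le_sup_left _ hA).inter (F.mono le_sup_right _ hB), by
      rw [prod_inter_prod, Ioi_inter_Ioi]⟩

theorem isCountablySpanning_predictableGenerators (F : Filtration ℝ≥0 mΩ) :
    IsCountablySpanning (predictableGenerators F) := by
  refine ⟨fun n => if n = 0 then {⊥} ×ˢ univ else Ioi 0 ×ˢ univ, fun n => ?_, ?_⟩
  · dsimp only
    split_ifs
    · exact Or.inl ⟨univ, MeasurableSet.univ, rfl⟩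
    · exact Or.inr ⟨0, univ, MeasurableSet.univ, rfl⟩
  · rw [eq_univ_iff_forall]
    rintro ⟨t, ω⟩
    rw [mem_iUnion]
    rcases eq_or_ne t 0 with rfl | h
    · exact ⟨0, by simp⟩
    · exact ⟨1, by simp [pos_iff_ne_zero.2 h]⟩

theorem predictableMarked_eq_generateFrom (F : Filtration ℝ≥0 mΩ) :
    predictableMarked F Y = MeasurableSpace.generateFrom
      (image2 (· ×ˢ ·) (predictableGenerators F) {s : Set Y | MeasurableSet s}) := by
  have h := @generateFrom_eq_prod (ℝ≥0 × Ω) Y F.predictable mY (predictableGenerators F)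
    {s : Set Y | MeasurableSet s} rfl MeasurableSpace.generateFrom_measurableSet
    (isCountablySpanning_predictableGenerators F) isCountablySpanning_measurableSet
  exact h.symm

variable {P : Measure Ω} {F : Filtration ℝ≥0 mΩ}
  {N : Ω → Measure (ℝ≥0 × Y)} {ν : Measure Y} [SFinite ν]

/-- The section is `Ioc i T ×ˢ (B ∩ D)` on `A` and empty off `A`, so the count is the indicator of
`A` times the noise of a set lying after time `i`. The first factor is known at time `i` and the
second is independent of `F i`, so the expectation factorises. -/
theorem campbell_Ioi_prod (hN : IsPoissonRandomMeasure P N (lebesgueNN.prod ν))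
    (hF : ∀ t, Indep (F t) (futureNoise N t) P) {T : ℝ≥0} {B : Set Y} (hB : MeasurableSet B)
    (hνB : ν B ≠ ∞) {i : ℝ≥0} {A : Set Ω} (hA : MeasurableSet[F i] A) {D : Set Y}
    (hD : MeasurableSet D) :
    AEMeasurable (fun ω => N ω (Ioc 0 T ×ˢ B ∩ pathSection ((Ioi i ×ˢ A) ×ˢ D) ω)) P ∧
    ∫⁻ ω, N ω (Ioc 0 T ×ˢ B ∩ pathSection ((Ioi i ×ˢ A) ×ˢ D) ω) ∂P
      = ∫⁻ ω, lebesgueNN.prod ν (Ioc 0 T ×ˢ B ∩ pathSection ((Ioi i ×ˢ A) ×ˢ D) ω) ∂P := by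
  classical
  have hsec : ∀ ω, Ioc 0 T ×ˢ B ∩ pathSection ((Ioi i ×ˢ A) ×ˢ D) ω
      = if ω ∈ A then Ioc i T ×ˢ (B ∩ D) else ∅ := by
    intro ω
    ext ⟨s, y⟩
    split_ifs with h
    · simp only [pathSection, mem_inter_iff, mem_prod, mem_Ioc, mem_ofPred_eq, mem_Ioi, h, and_true]
      constructor
      · tauto
      · rintro ⟨⟨h1, h2⟩, h3, h4⟩
        exact ⟨⟨⟨lt_of_le_of_lt (by simp) h1, h2⟩, h3⟩, h1, h4⟩
    · simp [pathSection, h]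
  have hm : MeasurableSet (Ioc i T ×ˢ (B ∩ D)) := measurableSet_Ioc.prod (hB.inter hD)
  have hval : ∀ m : Ω → Measure (ℝ≥0 × Y), ∀ ω,
      m ω (Ioc 0 T ×ˢ B ∩ pathSection ((Ioi i ×ˢ A) ×ˢ D) ω)
        = A.indicator 1 ω * m ω (Ioc i T ×ˢ (B ∩ D)) := by
    intro m ω
    rw [hsec]
    by_cases h : ω ∈ A <;> simp [h]
  have hA' := F.le i _ hA
  have hfin : lebesgueNN.prod ν (Ioc i T ×ˢ (B ∩ D)) ≠ ∞ := by
    rw [Measure.prod_prod, lebesgueNN_Ioc]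
    exact ENNReal.mul_ne_top ENNReal.ofReal_ne_top
      (ne_top_of_le_ne_top hνB (measure_mono inter_subset_left))
  simp_rw [hval N, hval (fun _ => lebesgueNN.prod ν)]
  refine ⟨((measurable_one.indicator hA').mul (hN.measurable_apply hm)).aemeasurable, ?_⟩
  have hfut : Measurable[futureNoise N i] (fun ω => N ω (Ioc i T ×ˢ (B ∩ D))) := by
    have h1 : (fun ω => N ω (Ioc i T ×ˢ (B ∩ D)))
        = (fun m : Measure (ℝ≥0 × Y) => m (Ioc i T ×ˢ (B ∩ D))) ∘
          (fun ω => (N ω).restrict (Ioi i ×ˢ univ)) := by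
      ext ω
      simp only [Function.comp_apply]
      have h2 : Ioc i T ×ˢ (B ∩ D) ⊆ Ioi i ×ˢ univ :=
        prod_mono (fun x hx => hx.1) (subset_univ _)
      rw [Measure.restrict_apply hm, inter_eq_left.2 h2]
    rw [h1]
    exact (Measure.measurable_coe hm).comp (comap_measurable _)
  have hind : Measurable[F i] (A.indicator (1 : Ω → ℝ≥0∞)) :=
    Measurable.indicator (m := F i) measurable_const hA
  rw [lintegral_mul_eq_lintegral_mul_lintegral_of_independent_measurableSpace (F.le i)
    (futureNoise_le hN.measurable i) (hF i) hind hfut,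
    hN.lintegral_apply hm hfin, lintegral_mul_const _ (measurable_one.indicator hA')]

variable [IsProbabilityMeasure P]

/-- Campbell's formula for a predictable set of points, within a window of finite intensity. -/
theorem campbell_window (hN : IsPoissonRandomMeasure P N (lebesgueNN.prod ν))
    (hF : ∀ t, Indep (F t) (futureNoise N t) P) (T : ℝ≥0) {B : Set Y} (hB : MeasurableSet B)
    (hνB : ν B ≠ ∞) {C : Set ((ℝ≥0 × Ω) × Y)} (hC : MeasurableSet[predictableMarked F Y] C) :
    AEMeasurable (fun ω => N ω (Ioc 0 T ×ˢ B ∩ pathSection C ω)) P ∧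
    ∫⁻ ω, N ω (Ioc 0 T ×ˢ B ∩ pathSection C ω) ∂P
      = ∫⁻ ω, lebesgueNN.prod ν (Ioc 0 T ×ˢ B ∩ pathSection C ω) ∂P := by
  have hK : MeasurableSet (Ioc 0 T ×ˢ B) := measurableSet_Ioc.prod hB
  have hfin : lebesgueNN.prod ν (Ioc 0 T ×ˢ B) ≠ ∞ := by
    rw [Measure.prod_prod, lebesgueNN_Ioc]
    exact ENNReal.mul_ne_top ENNReal.ofReal_ne_top hνB
  have hmeasμ : ∀ {C : Set ((ℝ≥0 × Ω) × Y)}, MeasurableSet[predictableMarked F Y] C →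
      AEMeasurable (fun ω => lebesgueNN.prod ν (Ioc 0 T ×ˢ B ∩ pathSection C ω)) P := by
    intro C hC
    have hm : MeasurableSet {p : Ω × (ℝ≥0 × Y) | p.2 ∈ Ioc 0 T ×ˢ B ∧ ((p.2.1, p.1), p.2.2) ∈ C} := by
      refine (measurable_snd hK).inter ?_
      have : Measurable (fun p : Ω × (ℝ≥0 × Y) => ((p.2.1, p.1), p.2.2)) := by fun_prop
      exact this (predictableMarked_le F _ hC)
    exact (measurable_measure_prodMk_left hm).aemeasurable
  refine MeasurableSpace.induction_on_inter (m := predictableMarked F Y)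
    (C := fun C _ => AEMeasurable (fun ω => N ω (Ioc 0 T ×ˢ B ∩ pathSection C ω)) P ∧
    ∫⁻ ω, N ω (Ioc 0 T ×ˢ B ∩ pathSection C ω) ∂P
      = ∫⁻ ω, lebesgueNN.prod ν (Ioc 0 T ×ˢ B ∩ pathSection C ω) ∂P)
    (predictableMarked_eq_generateFrom F)
    ((isPiSystem_predictableGenerators F).prod MeasurableSpace.isPiSystem_measurableSet)
    ?_ ?_ ?_ ?_ C hC
  · simp [pathSection]
  · rintro _ ⟨_, ⟨A, hA, rfl⟩ | ⟨i, A, hA, rfl⟩, D, hD, rfl⟩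
    -- Generators at time zero contribute nothing, because the window excludes time zero.
    · have : ∀ ω, Ioc 0 T ×ˢ B ∩ pathSection (({⊥} ×ˢ A) ×ˢ D) ω = ∅ := by
        intro ω
        ext ⟨s, y⟩
        simp only [pathSection, mem_inter_iff, mem_prod, mem_Ioc, mem_ofPred_eq, mem_singleton_iff,
          mem_empty_iff_false, iff_false]
        rintro ⟨⟨⟨h, -⟩, -⟩, ⟨rfl, -⟩, -⟩
        exact lt_irrefl _ h
      simp only [this, measure_empty]
      exact ⟨aemeasurable_const, trivial⟩
    · exact campbell_Ioi_prod hN hF hB hνB hA hD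
  · rintro C hC ⟨hm, hi⟩
    have hsec : ∀ ω, Ioc 0 T ×ˢ B ∩ pathSection Cᶜ ω
        = Ioc 0 T ×ˢ B \ (Ioc 0 T ×ˢ B ∩ pathSection C ω) := by
      intro ω
      rw [sdiff_self_inter]
      rfl
    have hmeas : ∀ ω, MeasurableSet (Ioc 0 T ×ˢ B ∩ pathSection C ω) := fun ω =>
      hK.inter (measurableSet_pathSection (predictableMarked_le F _ hC) ω)
    -- Complements are handled by subtraction, which needs the window to have finite mass. For `N ω`
    -- this holds only almost surely, hence a.e. measurability in the claim.
    have hN' : (fun ω => N ω (Ioc 0 T ×ˢ B ∩ pathSection Cᶜ ω)) =ᵐ[P]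
        fun ω => N ω (Ioc 0 T ×ˢ B) - N ω (Ioc 0 T ×ˢ B ∩ pathSection C ω) := by
      filter_upwards [hN.ae_ne_top hK hfin] with ω hω
      rw [hsec, measure_sdiff inter_subset_left (hmeas ω).nullMeasurableSet
        (ne_top_of_le_ne_top hω (measure_mono inter_subset_left))]
    have hμ' : ∀ ω, lebesgueNN.prod ν (Ioc 0 T ×ˢ B ∩ pathSection Cᶜ ω) =
        lebesgueNN.prod ν (Ioc 0 T ×ˢ B)
          - lebesgueNN.prod ν (Ioc 0 T ×ˢ B ∩ pathSection C ω) := by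
      intro ω
      rw [hsec, measure_sdiff inter_subset_left (hmeas ω).nullMeasurableSet
        (ne_top_of_le_ne_top hfin (measure_mono inter_subset_left))]
    have hNK := hN.measurable_apply hK
    refine ⟨(hNK.aemeasurable.sub hm).congr hN'.symm, ?_⟩
    have hle : ∫⁻ ω, N ω (Ioc 0 T ×ˢ B ∩ pathSection C ω) ∂P ≠ ∞ := by
      refine ne_top_of_le_ne_top hfin ?_
      rw [← hN.lintegral_apply hK hfin]
      exact lintegral_mono fun ω => measure_mono inter_subset_left
    rw [lintegral_congr_ae hN', lintegral_sub' hm hle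
      (ae_of_all _ fun ω => measure_mono inter_subset_left), hN.lintegral_apply hK hfin, hi]
    simp_rw [hμ']
    rw [lintegral_sub' (hmeasμ hC) (hi ▸ hle)
      (ae_of_all _ fun ω => measure_mono inter_subset_left)]
    simp
  · intro f hdisj hf ih
    have hsec : ∀ (m : Measure (ℝ≥0 × Y)) ω, m (Ioc 0 T ×ˢ B ∩ pathSection (⋃ n, f n) ω)
        = ∑' n, m (Ioc 0 T ×ˢ B ∩ pathSection (f n) ω) := by
      intro m ω
      have h1 : Ioc 0 T ×ˢ B ∩ pathSection (⋃ n, f n) ω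
          = ⋃ n, Ioc 0 T ×ˢ B ∩ pathSection (f n) ω := by
        ext x
        simp [pathSection]
      rw [h1, measure_iUnion]
      · intro i j hij
        refine disjoint_left.2 fun x hx hx' => ?_
        exact disjoint_left.1 (hdisj hij) hx.2 hx'.2
      · exact fun n => hK.inter (measurableSet_pathSection (predictableMarked_le F _ (hf n)) ω)
    simp_rw [hsec]
    refine ⟨AEMeasurable.tsum fun n => (ih n).1, ?_⟩
    rw [lintegral_tsum fun n => (ih n).1, lintegral_tsum fun n => hmeasμ (hf n)]
    exact tsum_congr fun n => (ih n).2

/-- Campbell's formula for a predictable set of points up to time `T`. -/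
theorem campbell (ν : Measure Y) [SigmaFinite ν]
    (hN : IsPoissonRandomMeasure P N (lebesgueNN.prod ν))
    (hF : ∀ t, Indep (F t) (futureNoise N t) P) (T : ℝ≥0)
    {C : Set ((ℝ≥0 × Ω) × Y)} (hC : MeasurableSet[predictableMarked F Y] C) :
    AEMeasurable (fun ω => N ω (Ioc 0 T ×ˢ univ ∩ pathSection C ω)) P ∧
    ∫⁻ ω, N ω (Ioc 0 T ×ˢ univ ∩ pathSection C ω) ∂P
      = ∫⁻ s in Ioc 0 T, ∫⁻ ω, ν {y | ((s, ω), y) ∈ C} ∂P ∂lebesgueNN := by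
  -- The mark space may have infinite intensity, as it does for the bounces. It is exhausted by sets
  -- of finite measure, and monotone convergence passes to the limit on both sides.
  have hmono : ∀ ω, Monotone fun n => Ioc 0 T ×ˢ spanningSets ν n ∩ pathSection C ω := fun ω i j h =>
    inter_subset_inter_left _ (prod_mono le_rfl (monotone_spanningSets ν h))
  have hsup : ∀ (m : Measure (ℝ≥0 × Y)) ω, m (Ioc 0 T ×ˢ univ ∩ pathSection C ω)
      = ⨆ n, m (Ioc 0 T ×ˢ spanningSets ν n ∩ pathSection C ω) := by
    intro m ω
    rw [← (hmono ω).measure_iUnion, ← iUnion_inter, ← prod_iUnion, iUnion_spanningSets]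
  have hc := fun n => campbell_window hN hF T (measurableSet_spanningSets ν n)
    (measure_spanningSets_lt_top ν n).ne hC
  have hmC := predictableMarked_le F _ hC
  have hm : ∀ n, MeasurableSet {p : Ω × (ℝ≥0 × Y) |
      p.2 ∈ Ioc 0 T ×ˢ spanningSets ν n ∧ ((p.2.1, p.1), p.2.2) ∈ C} := by
    intro n
    refine (measurable_snd (measurableSet_Ioc.prod (measurableSet_spanningSets ν n))).inter ?_
    have : Measurable (fun p : Ω × (ℝ≥0 × Y) => ((p.2.1, p.1), p.2.2)) := by fun_prop
    exact this hmC
  constructor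
  · simp_rw [hsup]
    exact AEMeasurable.iSup fun n => (hc n).1
  · have h1 : ∫⁻ ω, N ω (Ioc 0 T ×ˢ univ ∩ pathSection C ω) ∂P
        = ∫⁻ ω, lebesgueNN.prod ν (Ioc 0 T ×ˢ univ ∩ pathSection C ω) ∂P := by
      simp_rw [hsup]
      rw [lintegral_iSup' (fun n => (hc n).1)
          (ae_of_all _ fun ω i j h => measure_mono (hmono ω h)),
        lintegral_iSup' (μ := P) (f := fun n ω =>
            lebesgueNN.prod ν (Ioc 0 T ×ˢ spanningSets ν n ∩ pathSection C ω))
          (fun n => (measurable_measure_prodMk_left (hm n)).aemeasurable)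
          (ae_of_all _ fun ω i j h => measure_mono (hmono ω h))]
      exact iSup_congr fun n => (hc n).2
    rw [h1, lintegral_lintegral_swap (measurable_measure_prodMk_left hmC).aemeasurable]
    refine lintegral_congr fun ω => ?_
    rw [inter_comm, ← Measure.restrict_apply (measurableSet_pathSection hmC ω),
      ← Measure.prod_restrict, Measure.restrict_univ,
      Measure.prod_apply (measurableSet_pathSection hmC ω)]
    rfl

end Campbell

/-! ### Point measures -/

section PointMeasure

variable {X Y : Type*} [MeasurableSpace X] [MeasurableSpace Y]

theorem IsPointMeasure.restrict {m : Measure X} (hm : IsPointMeasure m) {s : Set X}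
    (hs : MeasurableSet s) : IsPointMeasure (m.restrict s) := by
  classical
  obtain ⟨I, x, rfl⟩ := hm
  refine ⟨{i | i ∈ I ∧ x i ∈ s}, x, ?_⟩
  ext A hA
  rw [Measure.restrict_apply hA, Measure.sum_apply _ (hA.inter hs), Measure.sum_apply _ hA,
    tsum_subtype I (fun i => Measure.dirac (x i) (A ∩ s)),
    tsum_subtype {i | i ∈ I ∧ x i ∈ s} (fun i => Measure.dirac (x i) A)]
  refine tsum_congr fun i => ?_
  simp only [indicator, mem_ofPred_eq, Measure.dirac_apply' _ (hA.inter hs),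
    Measure.dirac_apply' _ hA]
  by_cases h1 : i ∈ I <;> by_cases h2 : x i ∈ s <;> simp [h1, h2]

/-- Every function is a.e. constant under a point mass. Integrands containing left limits therefore
need no measurability argument of their own. -/
theorem IsPointMeasure.aestronglyMeasurable [MeasurableSingletonClass X] {E : Type*}
    [TopologicalSpace E] [TopologicalSpace.PseudoMetrizableSpace E] {m : Measure X}
    (hm : IsPointMeasure m) (f : X → E) : AEStronglyMeasurable f m := by
  obtain ⟨I, x, rfl⟩ := hm
  exact aestronglyMeasurable_sum_measure_iff.2 fun i => aestronglyMeasurable_dirac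

theorem IsPointMeasure.exists_eq_dirac {m : Measure X} (hm : IsPointMeasure m)
    (h1 : m univ ≤ 1) (h0 : m univ ≠ 0) : ∃ x, m = Measure.dirac x := by
  obtain ⟨I, x, rfl⟩ := hm
  rw [Measure.sum_apply _ MeasurableSet.univ] at h1 h0
  simp only [measure_univ, ENNReal.tsum_set_one] at h1 h0
  have h1' : I.encard ≤ 1 := by exact_mod_cast h1
  have h0' : I.Nonempty := by
    rw [← encard_ne_zero]
    exact_mod_cast h0
  obtain ⟨i, hi⟩ := h0'
  have hI : I = {i} := (encard_le_one_iff_subsingleton.1 h1').eq_singleton_of_mem hi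
  subst hI
  refine ⟨x i, ?_⟩
  ext A hA
  rw [Measure.sum_apply _ hA, tsum_fintype]
  simp

/-- A point measure with at most one point at each time has as many points as there are times
at which it has a point. -/
theorem IsPointMeasure.measure_univ_eq_encard {m : Measure (ℝ≥0 × Y)} (hm : IsPointMeasure m)
    (h : ∀ t, m ({t} ×ˢ univ) ≤ 1) :
    m univ = (({t : ℝ≥0 | m ({t} ×ˢ univ) ≠ 0}.encard : ℕ∞) : ℝ≥0∞) := by
  classical
  obtain ⟨I, x, rfl⟩ := hm
  have hms : ∀ t : ℝ≥0, MeasurableSet ({t} ×ˢ (univ : Set Y)) := fun t =>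
    (measurableSet_singleton t).prod MeasurableSet.univ
  have hval : ∀ t, Measure.sum (fun i : I => Measure.dirac (x i)) ({t} ×ˢ univ)
      = (({i | i ∈ I ∧ (x i).1 = t}.encard : ℕ∞) : ℝ≥0∞) := by
    intro t
    rw [Measure.sum_apply _ (hms t), ← ENNReal.tsum_set_one,
      tsum_subtype I (fun i => Measure.dirac (x i) ({t} ×ˢ univ)),
      tsum_subtype {i | i ∈ I ∧ (x i).1 = t} (fun _ => (1 : ℝ≥0∞))]
    refine tsum_congr fun i => ?_
    simp only [indicator, mem_ofPred_eq, Measure.dirac_apply' _ (hms t)]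
    by_cases h1 : i ∈ I <;> by_cases h2 : (x i).1 = t <;> simp [h1, h2]
  -- At most one point per time means that distinct indices have distinct times, so points and times
  -- are equally many.
  have hinj : InjOn (fun i => (x i).1) I := by
    intro i hi j hj hij
    have h1 := h (x j).1
    rw [hval] at h1
    have h2 : {i | i ∈ I ∧ (x i).1 = (x j).1}.encard ≤ 1 := by exact_mod_cast h1
    exact encard_le_one_iff.1 h2 i j ⟨hi, hij⟩ ⟨hj, rfl⟩
  have himg : {t : ℝ≥0 | Measure.sum (fun i : I => Measure.dirac (x i)) ({t} ×ˢ univ) ≠ 0}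
      = (fun i => (x i).1) '' I := by
    ext t
    rw [mem_ofPred_eq, hval]
    have : ((({i | i ∈ I ∧ (x i).1 = t}.encard : ℕ∞) : ℝ≥0∞) ≠ 0) ↔
        {i | i ∈ I ∧ (x i).1 = t}.Nonempty := by
      rw [← encard_ne_zero]
      norm_cast
    rw [this]
    rfl
  rw [himg, hinj.encard_image, Measure.sum_apply _ MeasurableSet.univ]
  simp only [measure_univ, ENNReal.tsum_set_one]

end PointMeasure

/-! ### Absence of simultaneous points -/

section Simultaneous

variable {Ω Y Z : Type*} {mΩ : MeasurableSpace Ω} [MeasurableSpace Y] [MeasurableSpace Z]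
  {P : Measure Ω} {N : Ω → Measure (ℝ≥0 × Y)} {R : Ω → Measure (ℝ≥0 × Z)}
  {ν : Measure Y} {η : Measure Z} [SFinite ν] [SFinite η]

theorem exists_mem_Ioc_strip {t T : ℝ≥0} (ht : t ∈ Ioc 0 T) (n : ℕ) (hn : 0 < n) :
    ∃ k < n, t ∈ Ioc (T * k / n) (T * (k + 1) / n) := by
  obtain ⟨h0, hT⟩ := ht
  have hT0 : 0 < T := h0.trans_le hT
  have hn' : (0 : ℝ≥0) < n := by exact_mod_cast hn
  -- The strip index is ⌈tn/T⌉ - 1; rounding up fits strips that are open on the left.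
  have hpos : 0 < ⌈t * n / T⌉₊ := Nat.ceil_pos.2 (by positivity)
  obtain ⟨k, hk⟩ := Nat.exists_eq_succ_of_ne_zero hpos.ne'
  have hle : t * n / T ≤ k + 1 := by
    have := Nat.le_ceil (t * n / T)
    rw [hk] at this
    exact_mod_cast this
  have hlt : (k : ℝ≥0) < t * n / T := Nat.lt_ceil.1 (by omega)
  refine ⟨k, ?_, ?_, ?_⟩
  · have : ⌈t * n / T⌉₊ ≤ n := by
      rw [Nat.ceil_le, div_le_iff₀ hT0, mul_comm]
      gcongr
    omega
  · rw [div_lt_iff₀ hn']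
    rwa [lt_div_iff₀ hT0, mul_comm] at hlt
  · rw [le_div_iff₀ hn']
    rwa [div_le_iff₀ hT0, mul_comm (_ + _)] at hle

/-- Two independent Poisson random measures have no simultaneous points. -/
theorem ae_no_simultaneous_points
    (hN : IsPoissonRandomMeasure P N (lebesgueNN.prod ν))
    (hR : IsPoissonRandomMeasure P R (lebesgueNN.prod η)) (hind : IndepFun N R P)
    {B : Set Y} (hB : MeasurableSet B) (hνB : ν B ≠ ∞) {D : Set Z} (hD : MeasurableSet D)
    (hηD : η D ≠ ∞) (T : ℝ≥0) :
    ∀ᵐ ω ∂P, ∀ t ∈ Ioc 0 T, N ω ({t} ×ˢ B) ≤ 1 ∧ R ω ({t} ×ˢ D) ≤ 1 ∧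
      (N ω ({t} ×ˢ B) = 0 ∨ R ω ({t} ×ˢ D) = 0) := by
  set K : ℝ≥0∞ := ν B ^ 2 + η D ^ 2 + ν B * η D with hK
  have hKtop : K ≠ ∞ := by
    simp [hK, ENNReal.add_eq_top, ENNReal.mul_eq_top, hνB, hηD]
  let J : ℕ → ℕ → Set ℝ≥0 := fun n k => Ioc (T * k / n) (T * (k + 1) / n)
  have hJ : ∀ n k, lebesgueNN (J n k) = ENNReal.ofReal (T / n) := by
    intro n k
    rw [lebesgueNN_Ioc]
    congr 1
    push_cast
    ring
  -- A strip is bad if it holds two points of one noise or a point of each. With strip length T/n,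
  -- each of the three events has probability of order (T/n)², and `K` collects the constants.
  let bad : ℕ → ℕ → Set Ω := fun n k =>
    {ω | 1 < N ω (J n k ×ˢ B)} ∪ {ω | 1 < R ω (J n k ×ˢ D)}
      ∪ {ω | N ω (J n k ×ˢ B) ≠ 0} ∩ {ω | R ω (J n k ×ˢ D) ≠ 0}
  have hbad : ∀ n k, P (bad n k) ≤ ENNReal.ofReal (T / n) ^ 2 * K := by
    intro n k
    have hmB : MeasurableSet (J n k ×ˢ B) := measurableSet_Ioc.prod hB
    have hmD : MeasurableSet (J n k ×ˢ D) := measurableSet_Ioc.prod hD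
    have hfB : lebesgueNN.prod ν (J n k ×ˢ B) = ENNReal.ofReal (T / n) * ν B := by
      rw [Measure.prod_prod, hJ]
    have hfD : lebesgueNN.prod η (J n k ×ˢ D) = ENNReal.ofReal (T / n) * η D := by
      rw [Measure.prod_prod, hJ]
    have hB' : lebesgueNN.prod ν (J n k ×ˢ B) ≠ ∞ := by
      rw [hfB]
      exact ENNReal.mul_ne_top ENNReal.ofReal_ne_top hνB
    have hD' : lebesgueNN.prod η (J n k ×ˢ D) ≠ ∞ := by
      rw [hfD]
      exact ENNReal.mul_ne_top ENNReal.ofReal_ne_top hηD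
    have hint : P ({ω | N ω (J n k ×ˢ B) ≠ 0} ∩ {ω | R ω (J n k ×ˢ D) ≠ 0})
        = P {ω | N ω (J n k ×ˢ B) ≠ 0} * P {ω | R ω (J n k ×ˢ D) ≠ 0} :=
      hind.measure_inter_preimage_eq_mul {m | m (J n k ×ˢ B) ≠ 0} {m | m (J n k ×ˢ D) ≠ 0}
        (Measure.measurable_coe hmB (measurableSet_singleton 0).compl)
        (Measure.measurable_coe hmD (measurableSet_singleton 0).compl)
    calc P (bad n k) ≤ (P {ω | 1 < N ω (J n k ×ˢ B)} + P {ω | 1 < R ω (J n k ×ˢ D)})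
          + P {ω | N ω (J n k ×ˢ B) ≠ 0} * P {ω | R ω (J n k ×ˢ D) ≠ 0} := by
          rw [← hint]
          exact (measure_union_le _ _).trans (add_le_add (measure_union_le _ _) le_rfl)
      _ ≤ ((ENNReal.ofReal (T / n) * ν B) ^ 2 + (ENNReal.ofReal (T / n) * η D) ^ 2)
          + (ENNReal.ofReal (T / n) * ν B) * (ENNReal.ofReal (T / n) * η D) := by
          rw [← hfB, ← hfD]
          exact add_le_add (add_le_add (hN.measure_one_lt_le hmB hB') (hR.measure_one_lt_le hmD hD'))
            (mul_le_mul' (hN.measure_ne_zero_le hmB hB') (hR.measure_ne_zero_le hmD hD'))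
      _ = ENNReal.ofReal (T / n) ^ 2 * K := by
          rw [hK]
          ring
  -- There are n + 1 strips, each bad with probability O((n + 1)⁻²), so the union has probability
  -- O((n + 1)⁻¹).
  have hbound : ∀ n : ℕ, P (⋃ k ∈ Finset.range (n + 1), bad (n + 1) k)
      ≤ ENNReal.ofReal (T / (n + 1 : ℕ)) * (T * K) := by
    intro n
    refine (measure_biUnion_finset_le _ _).trans ?_
    refine (Finset.sum_le_sum fun k _ => hbad (n + 1) k).trans ?_
    rw [Finset.sum_const, Finset.card_range, nsmul_eq_mul, sq]
    have : ((n + 1 : ℕ) : ℝ≥0∞) * ENNReal.ofReal (T / (n + 1 : ℕ)) = T := by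
      rw [← ENNReal.ofReal_natCast, ← ENNReal.ofReal_mul (by positivity), mul_div_cancel₀ _
        (by positivity), ENNReal.ofReal_coe_nnreal]
    calc ((n + 1 : ℕ) : ℝ≥0∞)
          * (ENNReal.ofReal (T / (n + 1 : ℕ)) * ENNReal.ofReal (T / (n + 1 : ℕ)) * K)
        = ENNReal.ofReal (T / (n + 1 : ℕ))
          * ((((n + 1 : ℕ) : ℝ≥0∞) * ENNReal.ofReal (T / (n + 1 : ℕ))) * K) := by ring
      _ ≤ _ := by rw [this]
  have hlim : Tendsto (fun n : ℕ => ENNReal.ofReal (T / (n + 1 : ℕ)) * (T * K)) atTop (nhds 0) := by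
    have h1 : Tendsto (fun n : ℕ => ENNReal.ofReal (T / (n + 1 : ℕ))) atTop (nhds 0) := by
      rw [← ENNReal.ofReal_zero]
      exact ENNReal.tendsto_ofReal
        ((tendsto_const_div_atTop_nhds_zero_nat (T : ℝ)).comp (tendsto_add_atTop_nat 1))
    have h2 := ENNReal.Tendsto.mul_const (b := T * K) h1
      (Or.inr (ENNReal.mul_ne_top ENNReal.coe_ne_top hKtop))
    rwa [zero_mul] at h2
  have hzero : P (⋂ n : ℕ, ⋃ k ∈ Finset.range (n + 1), bad (n + 1) k) = 0 :=
    le_antisymm (ge_of_tendsto' hlim fun n => (measure_mono (iInter_subset _ n)).trans (hbound n))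
      zero_le
  rw [ae_iff]
  -- Points sharing a time lie in a common strip at every mesh, so an exceptional outcome has a bad
  -- strip for every n.
  refine measure_mono_null (fun ω hω => ?_) hzero
  rw [mem_iInter]
  intro n
  by_contra hcon
  refine hω fun t ht => ?_
  obtain ⟨k, hk, htk⟩ := exists_mem_Ioc_strip ht (n + 1) n.succ_pos
  have hgood : ω ∉ bad (n + 1) k := fun h => hcon <| by
    simp only [mem_iUnion, Finset.mem_range]
    exact ⟨k, hk, h⟩
  have hsub : ({t} : Set ℝ≥0) ⊆ J (n + 1) k := by
    rw [singleton_subset_iff]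
    exact htk
  have hNle : N ω ({t} ×ˢ B) ≤ N ω (J (n + 1) k ×ˢ B) := measure_mono (prod_mono hsub le_rfl)
  have hRle : R ω ({t} ×ˢ D) ≤ R ω (J (n + 1) k ×ˢ D) := measure_mono (prod_mono hsub le_rfl)
  simp only [bad, mem_union, mem_inter_iff, mem_ofPred_eq, not_or, not_lt, not_and_or,
    not_not] at hgood
  refine ⟨hNle.trans hgood.1.1, hRle.trans hgood.1.2, ?_⟩
  rcases hgood.2 with h | h
  · exact Or.inl (le_antisymm (hNle.trans h.le) zero_le)
  · exact Or.inr (le_antisymm (hRle.trans h.le) zero_le)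

end Simultaneous

/-! ### Predictable versions of left limits -/

noncomputable section LeftVersion

/-- The last point before `s` of the grid of mesh `1 / (n + 1)`. -/
def leftGrid (n : ℕ) (s : ℝ≥0) : ℝ≥0 := ((⌈s * (n + 1)⌉₊ - 1 : ℕ) : ℝ≥0) / (n + 1)

theorem leftGrid_eq_iff {n k : ℕ} {s : ℝ≥0} (hs : 0 < s) :
    ⌈s * (n + 1)⌉₊ - 1 = k ↔ s ∈ Ioc ((k : ℝ≥0) / (n + 1)) (((k + 1 : ℕ) : ℝ≥0) / (n + 1)) := by
  have hn : (0 : ℝ≥0) < n + 1 := by positivity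
  have hpos : 0 < ⌈s * (n + 1)⌉₊ := Nat.ceil_pos.2 (by positivity)
  rw [mem_Ioc, div_lt_iff₀ hn, le_div_iff₀ hn, ← Nat.lt_ceil, ← Nat.ceil_le]
  omega

theorem leftGrid_lt (n : ℕ) {s : ℝ≥0} (hs : 0 < s) : leftGrid n s < s :=
  ((leftGrid_eq_iff (n := n) hs).1 rfl).1

theorem le_leftGrid_add (n : ℕ) (s : ℝ≥0) : (s : ℝ) - 1 / ((n : ℝ) + 1) ≤ leftGrid n s := by
  rcases eq_or_ne s 0 with rfl | h
  · simp only [NNReal.coe_zero, zero_sub]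
    have h1 : (0 : ℝ) ≤ leftGrid n 0 := NNReal.coe_nonneg _
    have h2 : (0 : ℝ) < 1 / ((n : ℝ) + 1) := by positivity
    linarith
  · have h1 := ((leftGrid_eq_iff (n := n) (pos_iff_ne_zero.2 h)).1 rfl).2
    have h2 : (s : ℝ) ≤ leftGrid n s + 1 / ((n : ℝ) + 1) := by
      have h3 : s ≤ leftGrid n s + 1 / (n + 1) := by
        rw [leftGrid, ← add_div]
        exact_mod_cast h1
      exact_mod_cast h3
    linarith

theorem tendsto_leftGrid {s : ℝ≥0} (hs : 0 < s) :
    Tendsto (fun n => leftGrid n s) atTop (nhdsWithin s (Iio s)) := by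
  refine tendsto_nhdsWithin_iff.2 ⟨?_, Eventually.of_forall fun n => leftGrid_lt n hs⟩
  rw [← NNReal.tendsto_coe]
  refine tendsto_of_tendsto_of_tendsto_of_le_of_le (g := fun n : ℕ => (s : ℝ) - 1 / ((n : ℝ) + 1))
    (h := fun _ => (s : ℝ)) ?_ tendsto_const_nhds (fun n => le_leftGrid_add n s)
    (fun n => by exact_mod_cast (leftGrid_lt n hs).le)
  simpa using (tendsto_const_nhds (x := (s : ℝ))).sub
    (tendsto_one_div_add_atTop_nhds_zero_nat (𝕜 := ℝ))

variable {Ω E : Type*} {mΩ : MeasurableSpace Ω} {F : Filtration ℝ≥0 mΩ}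

/-- On each interval (k/(n+1), (k+1)/(n+1)] the process is frozen at its value at the left endpoint,
so preimages are countable unions of predictable rectangles. At time zero truncated subtraction
gives the grid point 0, whence the extra rectangle. -/
theorem measurable_predictable_leftGrid [MeasurableSpace E] {x : ℝ≥0 → Ω → E} (hx : Adapted F x)
    (n : ℕ) : Measurable[F.predictable] fun p : ℝ≥0 × Ω => x (leftGrid n p.1) p.2 := by
  intro B hB
  have h : (fun p : ℝ≥0 × Ω => x (leftGrid n p.1) p.2) ⁻¹' B
      = ({⊥} ×ˢ (x 0 ⁻¹' B)) ∪ ⋃ k : ℕ, Ioc ((k : ℝ≥0) / (n + 1)) (((k + 1 : ℕ) : ℝ≥0) / (n + 1))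
          ×ˢ (x ((k : ℝ≥0) / (n + 1)) ⁻¹' B) := by
    ext ⟨s, ω⟩
    rcases eq_or_ne s 0 with rfl | hs
    · simp [leftGrid]
    · have h0 := fun k => leftGrid_eq_iff (n := n) (k := k) (pos_iff_ne_zero.2 hs)
      simp only [mem_preimage, mem_union, mem_prod, mem_iUnion, bot_eq_zero', mem_singleton_iff,
        hs, false_and, false_or]
      constructor
      · intro hmem
        exact ⟨_, (h0 _).1 rfl, hmem⟩
      · rintro ⟨k, hk, hmem⟩
        rwa [leftGrid, (h0 k).2 hk]
  rw [h]
  refine MeasurableSet.union ?_ (MeasurableSet.iUnion fun k => ?_)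
  · exact measurableSet_predictable_singleton_bot_prod (hx 0 hB)
  · exact measurableSet_predictable_Ioc_prod _ _ (hx _ hB)

/-- The process of left limits of `x`, as a limit along grids. -/
def leftVersion [TopologicalSpace E] [Nonempty E] (x : ℝ≥0 → Ω → E) (s : ℝ≥0) (ω : Ω) : E :=
  limUnder atTop fun n => x (leftGrid n s) ω

/-- A sequential limit of predictable maps is predictable even if convergence fails at some
outcomes. The pair of position and velocity is only known to have left limits almost surely, which
is why limits along grids are used. -/
theorem measurable_predictable_leftVersion [TopologicalSpace E] [Nonempty E] [MeasurableSpace E]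
    [BorelSpace E] [PolishSpace E] {x : ℝ≥0 → Ω → E} (hx : Adapted F x) :
    Measurable[F.predictable] fun p : ℝ≥0 × Ω => leftVersion x p.1 p.2 :=
  letI := F.predictable
  (StronglyMeasurable.limUnder fun n =>
    (measurable_predictable_leftGrid hx n).stronglyMeasurable).measurable

theorem leftVersion_eq_leftLim [TopologicalSpace E] [Nonempty E] [T2Space E] {x : ℝ≥0 → Ω → E}
    {s : ℝ≥0} (hs : 0 < s) {ω : Ω} {l : E}
    (h : Tendsto (fun t => x t ω) (nhdsWithin s (Iio s)) (nhds l)) : leftVersion x s ω = l :=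
  (h.comp (tendsto_leftGrid hs)).limUnder_eq

/-- The left limits of a process with constant one-time law have that law. -/
theorem map_leftVersion [TopologicalSpace E] [Nonempty E] [MeasurableSpace E]
    [BorelSpace E] [PolishSpace E] {P : Measure Ω} [IsProbabilityMeasure P] {x : ℝ≥0 → Ω → E}
    (hx : Adapted F x) {μ : Measure E} (hμ : ∀ t, P.map (x t) = μ) {s : ℝ≥0} (hs : 0 < s)
    (h : ∀ᵐ ω ∂P, ∃ l, Tendsto (fun t => x t ω) (nhdsWithin s (Iio s)) (nhds l)) :
    P.map (leftVersion x s) = μ := by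
  have hxm : ∀ t, Measurable (x t) := fun t => (hx t).mono (F.le t) le_rfl
  have hjoint : Measurable fun p : ℝ≥0 × Ω => leftVersion x p.1 p.2 := fun B hB =>
    predictable_le_prod F _ (measurable_predictable_leftVersion hx hB)
  have hlm : Measurable (leftVersion x s) := hjoint.of_uncurry_left
  have : IsProbabilityMeasure μ := by
    rw [← hμ 0]
    exact Measure.isProbabilityMeasure_map (hxm 0).aemeasurable
  have : IsProbabilityMeasure (P.map (leftVersion x s)) :=
    Measure.isProbabilityMeasure_map hlm.aemeasurable
  -- Bounded continuous `f` determine the law. Along the grid the expectation of `f` is constant,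
  -- and dominated convergence carries it to the left limit.
  refine ext_of_forall_integral_eq_of_IsFiniteMeasure fun f => ?_
  rw [integral_map hlm.aemeasurable f.continuous.aestronglyMeasurable]
  have h1 : Tendsto (fun n => ∫ ω, f (x (leftGrid n s) ω) ∂P) atTop
      (nhds (∫ ω, f (leftVersion x s ω) ∂P)) := by
    refine tendsto_integral_of_dominated_convergence (fun _ => ‖f‖)
      (fun n => (f.continuous.measurable.comp (hxm _)).aestronglyMeasurable)
      (integrable_const _) (fun n => ae_of_all _ fun ω => f.norm_coe_le_norm _) ?_
    filter_upwards [h] with ω ⟨l, hl⟩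
    rw [leftVersion_eq_leftLim hs hl]
    exact (f.continuous.tendsto l).comp (hl.comp (tendsto_leftGrid hs))
  refine tendsto_nhds_unique h1 ?_
  have h2 : ∀ n, ∫ ω, f (x (leftGrid n s) ω) ∂P = ∫ y, f y ∂μ := by
    intro n
    rw [← hμ (leftGrid n s), integral_map (hxm _).aemeasurable f.continuous.aestronglyMeasurable]
  simp_rw [h2]
  exact tendsto_const_nhds

end LeftVersion

/-! ### Gaussian and spherical computations under the target law -/

noncomputable section Target

open scoped Pointwise

theorem map_inner_stdGaussian {E : Type*} [NormedAddCommGroup E] [InnerProductSpace ℝ E]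
    [FiniteDimensional ℝ E] [MeasurableSpace E] [BorelSpace E] (w : E) :
    (stdGaussian E).map (fun x => inner ℝ x w) = gaussianReal 0 (‖w‖₊ ^ 2) := by
  have h := IsGaussian.map_eq_gaussianReal (μ := stdGaussian E) (innerSL ℝ w)
  rw [integral_strongDual_stdGaussian, variance_dual_stdGaussian, innerSL_apply_norm] at h
  have h1 : (fun x => inner ℝ x w) = (innerSL ℝ w : E → ℝ) := by
    ext x
    rw [innerSL_apply_apply, real_inner_comm]
  rw [h1, h]
  congr 1
  rw [Real.toNNReal_pow (norm_nonneg w)]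
  simp

theorem lintegral_posPart_gaussianReal :
    ∫⁻ x, ENNReal.ofReal (max x 0) ∂(gaussianReal 0 1)
      = ENNReal.ofReal (1 / Real.sqrt (2 * Real.pi)) := by
  set c : ℝ := 1 / Real.sqrt (2 * Real.pi) with hc
  have hc0 : 0 ≤ c := by positivity
  -- The normal density φ satisfies xφ(x) = (-φ)'(x), so the integral over the positive half-line is
  -- φ(0) = `c`.
  let g : ℝ → ℝ := fun x => -c * Real.exp (-x ^ 2 / 2)
  let g' : ℝ → ℝ := fun x => x * (c * Real.exp (-x ^ 2 / 2))
  have hderiv : ∀ x ∈ Ici (0 : ℝ), HasDerivAt g (g' x) x := by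
    intro x _
    have h1 : HasDerivAt (fun x : ℝ => -x ^ 2 / 2) (-x) x := by
      have := ((hasDerivAt_pow 2 x).fun_neg).div_const 2
      refine this.congr_deriv ?_
      push_cast
      ring
    have h2 := (h1.exp).const_mul (-c)
    refine h2.congr_deriv ?_
    simp only [g']
    ring
  have hpos : ∀ x ∈ Ioi (0 : ℝ), 0 ≤ g' x := fun x hx => by
    have : (0 : ℝ) < x := hx
    simp only [g']
    positivity
  have hlim : Tendsto g atTop (nhds 0) := by
    have h1 : Tendsto (fun x : ℝ => -x ^ 2 / 2) atTop atBot := by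
      have h2 : Tendsto (fun x : ℝ => x ^ 2 / 2) atTop atTop :=
        (tendsto_pow_atTop two_ne_zero).atTop_div_const two_pos
      have h3 := tendsto_neg_atTop_atBot.comp h2
      refine h3.congr fun x => ?_
      simp only [Function.comp_apply]
      ring
    have h2 := (Real.tendsto_exp_atBot.comp h1).const_mul (-c)
    rwa [mul_zero] at h2
  have hint := integral_Ioi_of_hasDerivAt_of_nonneg' hderiv hpos hlim
  have hintg := integrableOn_Ioi_deriv_of_nonneg' hderiv hpos hlim
  rw [gaussianReal_of_var_ne_zero 0 one_ne_zero,
    lintegral_withDensity_eq_lintegral_mul _ (measurable_gaussianPDF 0 1) (by fun_prop)]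
  have h3 : ∀ x : ℝ, (gaussianPDF 0 1 * fun x => ENNReal.ofReal (max x 0)) x
      = (Ioi (0 : ℝ)).indicator (fun x => ENNReal.ofReal (g' x)) x := by
    intro x
    by_cases hx : x ∈ Ioi (0 : ℝ)
    · have hx' : (0 : ℝ) < x := hx
      rw [indicator_of_mem hx, Pi.mul_apply, gaussianPDF, max_eq_left hx'.le, mul_comm,
        ← ENNReal.ofReal_mul hx'.le]
      congr 1
      simp [g', gaussianPDFReal, hc]
    · have hx' : x ≤ 0 := not_lt.1 hx
      rw [indicator_of_notMem hx, Pi.mul_apply, max_eq_right hx']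
      simp
  simp_rw [h3]
  rw [lintegral_indicator measurableSet_Ioi, ← ofReal_integral_eq_lintegral_ofReal hintg
    ((ae_restrict_iff' measurableSet_Ioi).2 (ae_of_all _ hpos)), hint]
  simp [g]

variable {d : ℕ}

theorem isProbabilityMeasure_sphereUniform (hd : 2 ≤ d) :
    IsProbabilityMeasure (sphereUniform d) := by
  have : Nonempty (Fin d) := ⟨⟨0, by omega⟩⟩
  refine ⟨?_⟩
  rw [sphereUniform, Measure.smul_apply, smul_eq_mul]
  refine ENNReal.inv_mul_cancel ?_ (measure_ne_top _ _)
  rw [Ne, Measure.measure_univ_eq_zero]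
  exact Measure.toSphere_ne_zero _

/-- The cone over a point lies in a line, which is a proper subspace as d ≥ 2 and hence Lebesgue
null. In dimension one the sphere consists of two atoms. -/
theorem sphereUniform_singleton (hd : 2 ≤ d) (v : USphere d) : sphereUniform d {v} = 0 := by
  rw [sphereUniform, Measure.smul_apply, Measure.toSphere_apply' _ (measurableSet_singleton v),
    smul_eq_mul]
  have h : (volume : Measure (Euc d)) (Ioo (0 : ℝ) 1 • ((fun u : USphere d => (u : Euc d)) '' {v})) = 0 := by
    have hne : Submodule.span ℝ {(v : Euc d)} ≠ ⊤ := by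
      intro htop
      have h1 := finrank_span_le_card (R := ℝ) ({(v : Euc d)} : Set (Euc d))
      rw [htop, finrank_top] at h1
      simp at h1
      omega
    refine measure_mono_null ?_ (Measure.addHaar_submodule volume _ hne)
    rintro _ ⟨a, -, _, ⟨u, rfl, rfl⟩, rfl⟩
    exact Submodule.smul_mem _ _ (Submodule.mem_span_singleton_self _)
  exact mul_eq_zero_of_right _ (mul_eq_zero_of_right _ h)

/-- Given v, the variable ⟨ξ, v⟩ is normal with variance ‖v‖² = 1. The dimension drops out here. -/
theorem lintegral_bounceRate_bpsTarget (hd : 2 ≤ d) :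
    ∫⁻ x, ENNReal.ofReal (bounceRate x.1 (x.2 : Euc d)) ∂(bpsTarget d)
      = ENNReal.ofReal (1 / Real.sqrt (2 * Real.pi)) := by
  have := isProbabilityMeasure_sphereUniform hd
  have hm : Measurable fun x : Euc d × USphere d =>
      ENNReal.ofReal (bounceRate x.1 (x.2 : Euc d)) := by
    unfold bounceRate
    fun_prop
  rw [bpsTarget, lintegral_prod_symm _ hm.aemeasurable]
  have h : ∀ v : USphere d, ∫⁻ ξ, ENNReal.ofReal (bounceRate ξ (v : Euc d)) ∂(stdGaussian (Euc d))
      = ENNReal.ofReal (1 / Real.sqrt (2 * Real.pi)) := by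
    intro v
    have hv : ‖(v : Euc d)‖₊ ^ 2 = 1 := by
      have : ‖(v : Euc d)‖₊ = 1 := by
        ext
        simp
      rw [this, one_pow]
    rw [← lintegral_posPart_gaussianReal, ← hv, ← map_inner_stdGaussian,
      lintegral_map (by fun_prop) (by fun_prop)]
    rfl
  simp [h]

/-- Under the target law a uniform refreshment almost surely changes the angular momentum. -/
theorem lintegral_refresh_null (hd : 2 ≤ d) :
    ∫⁻ x, sphereUniform d {u | inner ℝ x.1 ((u : Euc d) - (x.2 : Euc d)) = 0} ∂(bpsTarget d) = 0 := by
  have := isProbabilityMeasure_sphereUniform hd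
  have hm : MeasurableSet {p : (Euc d × USphere d) × USphere d |
      inner ℝ p.1.1 ((p.2 : Euc d) - (p.1.2 : Euc d)) = 0} := by
    refine measurableSet_eq_fun ?_ measurable_const
    fun_prop
  have hm1 : Measurable fun x : Euc d × USphere d =>
      sphereUniform d {u | inner ℝ x.1 ((u : Euc d) - (x.2 : Euc d)) = 0} :=
    measurable_measure_prodMk_left (ν := sphereUniform d) hm
  rw [bpsTarget, lintegral_prod_symm _ hm1.aemeasurable]
  have h : ∀ v : USphere d, ∫⁻ ξ, sphereUniform d {u | inner ℝ ξ ((u : Euc d) - (v : Euc d)) = 0}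
      ∂(stdGaussian (Euc d)) = 0 := by
    intro v
    have hmv : MeasurableSet {p : Euc d × USphere d |
        inner ℝ p.1 ((p.2 : Euc d) - (v : Euc d)) = 0} := by
      refine measurableSet_eq_fun ?_ measurable_const
      fun_prop
    have h1 := Measure.prod_apply (μ := stdGaussian (Euc d)) (ν := sphereUniform d) hmv
    have h2 := Measure.prod_apply_symm (μ := stdGaussian (Euc d)) (ν := sphereUniform d) hmv
    -- By Fubini the position may be integrated first: for u ≠ v the variable ⟨ξ, u - v⟩ is Gaussian
    -- with positive variance, so it has no atom at 0.
    have h3 : ∫⁻ u, stdGaussian (Euc d) ((fun ξ => (ξ, u)) ⁻¹' {p : Euc d × USphere d |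
        inner ℝ p.1 ((p.2 : Euc d) - (v : Euc d)) = 0}) ∂(sphereUniform d) = 0 := by
      rw [lintegral_eq_zero_iff (measurable_measure_prodMk_right hmv)]
      have hne : ∀ᵐ u ∂(sphereUniform d), u ≠ v := by
        rw [ae_iff]
        simpa using sphereUniform_singleton hd v
      filter_upwards [hne] with u hu
      have hw : (u : Euc d) - (v : Euc d) ≠ 0 := sub_ne_zero.2 fun h => hu (Subtype.ext h)
      have hw' : ‖(u : Euc d) - (v : Euc d)‖₊ ^ 2 ≠ 0 := by simpa using hw
      have h4 := Measure.map_apply (μ := stdGaussian (Euc d))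
        (f := fun ξ => inner ℝ ξ ((u : Euc d) - (v : Euc d))) (by fun_prop)
        (measurableSet_singleton (0 : ℝ))
      rw [map_inner_stdGaussian] at h4
      have := nullSingletonClass_gaussianReal (μ := 0) hw'
      rw [measure_singleton] at h4
      exact h4.symm
    rw [← h2, h1] at h3
    exact h3
  simp [h]

end Target

/-! ### Pathwise analysis of the jumps -/

noncomputable section Paths

/-- The function is the pointwise limit of its samples at the next grid point on the right, each of
which factors through ℕ. -/
theorem measurable_of_rightContinuous {E : Type*} [TopologicalSpace E]
    [TopologicalSpace.PseudoMetrizableSpace E] [MeasurableSpace E] [BorelSpace E] {f : ℝ≥0 → E}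
    (hf : ∀ t, ContinuousWithinAt f (Ici t) t) : Measurable f := by
  let g : ℕ → ℝ≥0 → ℝ≥0 := fun n s => ((⌊s * (n + 1)⌋₊ + 1 : ℕ) : ℝ≥0) / (n + 1)
  have hg : ∀ n, Measurable fun s => f (g n s) := fun n =>
    (measurable_from_nat (f := fun k : ℕ => f (((k + 1 : ℕ) : ℝ≥0) / (n + 1)))).comp
      (Nat.measurable_floor.comp (measurable_id.mul_const _))
  refine measurable_of_tendsto_metrizable hg (tendsto_pi_nhds.2 fun s => ?_)
  have hle : ∀ n, s ≤ g n s := fun n => by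
    have h1 := (Nat.lt_floor_add_one (s * ((n : ℝ≥0) + 1))).le
    have hn : (0 : ℝ≥0) < n + 1 := by positivity
    rw [le_div_iff₀ hn]
    exact_mod_cast h1
  have hge : ∀ n, g n s ≤ s + 1 / (n + 1) := fun n => by
    have h1 : (⌊s * ((n : ℝ≥0) + 1)⌋₊ : ℝ≥0) ≤ s * (n + 1) := Nat.floor_le zero_le
    have hn : (0 : ℝ≥0) < n + 1 := by positivity
    rw [div_le_iff₀ hn, add_mul, one_div, inv_mul_cancel₀ hn.ne']
    push_cast
    gcongr
  have hlim : Tendsto (fun n => g n s) atTop (nhdsWithin s (Ici s)) := by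
    refine tendsto_nhdsWithin_iff.2 ⟨?_, Eventually.of_forall hle⟩
    refine tendsto_of_tendsto_of_tendsto_of_le_of_le (g := fun _ : ℕ => s)
      (h := fun n : ℕ => s + 1 / ((n : ℝ≥0) + 1)) tendsto_const_nhds ?_ hle hge
    simpa using (tendsto_const_nhds (x := s)).add
      (tendsto_one_div_add_atTop_nhds_zero_nat (𝕜 := ℝ≥0))
  exact (hf s).tendsto.comp hlim

/-- Unit speed makes the position 1-Lipschitz. -/
theorem continuous_of_eq_add_integral {d : ℕ} {x : ℝ≥0 → Euc d} {w : ℝ≥0 → USphere d}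
    (hw : Measurable w)
    (hx : ∀ t, x t = x 0 + ∫ s in Icc 0 t, (w s : Euc d) ∂lebesgueNN) : Continuous x := by
  have hint : ∀ t, IntegrableOn (fun s => (w s : Euc d)) (Icc 0 t) lebesgueNN := by
    intro t
    refine IntegrableOn.of_bound ?_ (measurable_subtype_coe.comp hw).aestronglyMeasurable 1
      (ae_of_all _ fun s => by simp)
    rw [lebesgueNN_Icc_zero]
    exact ENNReal.coe_lt_top
  have key : ∀ s t, s ≤ t → dist (x t) (x s) ≤ dist t s := by
    intro s t hst
    have h1 : x t - x s = ∫ s in Ioc s t, (w s : Euc d) ∂lebesgueNN := by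
      rw [hx t, hx s, ← Icc_union_Ioc_eq_Icc zero_le hst, setIntegral_union
        (disjoint_left.2 fun y hy hy' => not_le.2 hy'.1 hy.2) measurableSet_Ioc (hint s)
        ((hint t).mono_set fun y hy => ⟨zero_le, hy.2⟩)]
      abel
    rw [dist_eq_norm, h1]
    have h2 := norm_setIntegral_le_of_norm_le_const (μ := lebesgueNN) (s := Ioc s t)
      (f := fun s => (w s : Euc d)) (C := 1)
      (by rw [lebesgueNN_Ioc]; exact ENNReal.ofReal_lt_top) (fun s _ => by simp)
    refine h2.trans ?_
    rw [measureReal_def, lebesgueNN_Ioc, ENNReal.toReal_ofReal (sub_nonneg.2 (by exact_mod_cast hst)),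
      one_mul, NNReal.dist_eq]
    exact le_abs_self _
  refine (LipschitzWith.of_dist_le_mul (K := 1) fun t s => ?_).continuous
  rw [NNReal.coe_one, one_mul]
  rcases le_total s t with h | h
  · exact key s t h
  · rw [dist_comm, dist_comm t]
    exact key t s h

/-- The jump at time `t` of the integral of `f` over `[0, t] × Y`. -/
theorem tendsto_setIntegral_Icc_prod {Y E : Type*} [MeasurableSpace Y]
    [NormedAddCommGroup E] [NormedSpace ℝ E] {m : Measure (ℝ≥0 × Y)} {f : ℝ≥0 × Y → E}
    {t : ℝ≥0} {u : ℕ → ℝ≥0} (hu : Monotone u) (hut : ∀ n, u n < t)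
    (hlim : Tendsto u atTop (nhds t)) (hf : IntegrableOn f (Icc 0 t ×ˢ univ) m) :
    Tendsto (fun n => ∫ p in Icc 0 (u n) ×ˢ univ, f p ∂m) atTop
      (nhds ((∫ p in Icc 0 t ×ˢ univ, f p ∂m) - ∫ p in {t} ×ˢ univ, f p ∂m)) := by
  have hU : ⋃ n, Icc 0 (u n) ×ˢ (univ : Set Y) = Ico 0 t ×ˢ univ := by
    ext ⟨s, y⟩
    simp only [mem_iUnion, mem_prod, mem_Icc, mem_univ, and_true, mem_Ico, zero_le, true_and]
    constructor
    · rintro ⟨n, hn⟩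
      exact hn.trans_lt (hut n)
    · intro hs
      obtain ⟨n, hn⟩ := (hlim.eventually (lt_mem_nhds hs)).exists
      exact ⟨n, hn.le⟩
  have h1 := tendsto_setIntegral_of_monotone (μ := m) (f := f)
    (s := fun n => Icc 0 (u n) ×ˢ (univ : Set Y))
    (fun n => measurableSet_Icc.prod MeasurableSet.univ)
    (fun i j hij => Set.prod_mono (Icc_subset_Icc le_rfl (hu hij)) le_rfl)
    (by rw [hU]; exact hf.mono_set (Set.prod_mono Ico_subset_Icc_self le_rfl))
  rw [hU] at h1
  have h2 : (∫ p in Icc 0 t ×ˢ univ, f p ∂m)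
      = (∫ p in Ico 0 t ×ˢ univ, f p ∂m) + ∫ p in {t} ×ˢ univ, f p ∂m := by
    have h3 : (Icc 0 t ×ˢ univ : Set (ℝ≥0 × Y)) = Ico 0 t ×ˢ univ ∪ {t} ×ˢ univ := by
      rw [← union_prod, Ico_union_right zero_le]
    rw [h3, setIntegral_union]
    · exact Disjoint.set_prod_left (by simp) _ _
    · exact (measurableSet_singleton t).prod MeasurableSet.univ
    · exact hf.mono_set (Set.prod_mono Ico_subset_Icc_self le_rfl)
    · exact hf.mono_set (Set.prod_mono (by simp) le_rfl)
  rw [h2, add_sub_cancel_right]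
  exact h1

variable {d : ℕ}

theorem norm_bounce_sub_le (ξ : Euc d) (v : USphere d) :
    ‖bounce ξ (v : Euc d) - (v : Euc d)‖ ≤ 2 := by
  rcases eq_or_ne ξ 0 with rfl | h
  · simp [bounce]
  · have hξ : 0 < ‖ξ‖ := norm_pos_iff.2 h
    have h1 : |inner ℝ ξ (v : Euc d)| ≤ ‖ξ‖ := by
      simpa using abs_real_inner_le_norm ξ (v : Euc d)
    rw [bounce, sub_sub_cancel_left, norm_neg, norm_smul, Real.norm_eq_abs, abs_div, abs_mul,
      abs_two, abs_of_nonneg (sq_nonneg ‖ξ‖), div_mul_eq_mul_div, div_le_iff₀ (by positivity)]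
    nlinarith

/-- Reflection negates the component along `ξ`; at `ξ = 0` both sides vanish. -/
theorem inner_bounce_sub (ξ v : Euc d) :
    inner ℝ ξ (bounce ξ v - v) = -2 * inner ℝ ξ v := by
  rcases eq_or_ne ξ 0 with rfl | h
  · simp
  · have hξ : ‖ξ‖ ≠ 0 := norm_ne_zero_iff.2 h
    rw [bounce, sub_sub_cancel_left, inner_neg_right, inner_smul_right,
      real_inner_self_eq_norm_sq]
    field_simp

/-- Almost sure properties of the path of the sampler and of its driving noise up to time `T`. -/
structure RegularPath (x : ℝ≥0 → Euc d) (w : ℝ≥0 → USphere d) (n : Measure (ℝ≥0 × ℝ≥0))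
    (r : Measure (ℝ≥0 × USphere d)) (T : ℝ≥0) : Prop where
  pointMeasure_bounce : IsPointMeasure n
  pointMeasure_refresh : IsPointMeasure r
  continuous_pos : Continuous x
  left_lim : ∀ t, ∃ l, Tendsto w (nhdsWithin t (Iio t)) (nhds l)
  vel_eq : ∀ t, (w t : Euc d) = (w 0 : Euc d)
    + (∫ p in Icc 0 t ×ˢ univ, bounceJump x w p.1 p.2 ∂n)
    + ∫ p in Icc 0 t ×ˢ univ, ((p.2 : Euc d) - ((Function.leftLim w p.1 : USphere d) : Euc d)) ∂r
  finite_bounce : ∀ M : ℕ, n (Icc 0 T ×ˢ Iic (M : ℝ≥0)) ≠ ∞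
  finite_refresh : r (Icc 0 T ×ˢ univ) ≠ ∞
  bounce_pos : n (Icc 0 T ×ˢ {0}) = 0
  simple : ∀ M : ℕ, ∀ t ∈ Ioc 0 T, n ({t} ×ˢ Iic (M : ℝ≥0)) ≤ 1 ∧ r ({t} ×ˢ univ) ≤ 1 ∧
    (n ({t} ×ˢ Iic (M : ℝ≥0)) = 0 ∨ r ({t} ×ˢ univ) = 0)
  refresh : r (Ioc 0 T ×ˢ univ ∩
    {p | inner ℝ (x p.1) ((p.2 : Euc d) - ((Function.leftLim w p.1 : USphere d) : Euc d)) = 0}) = 0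

namespace RegularPath

variable {x : ℝ≥0 → Euc d} {w : ℝ≥0 → USphere d} {n : Measure (ℝ≥0 × ℝ≥0)}
  {r : Measure (ℝ≥0 × USphere d)} {T : ℝ≥0}

theorem leftLim_pos (h : RegularPath x w n r T) (t : ℝ≥0) : Function.leftLim x t = x t :=
  h.continuous_pos.continuousAt.continuousWithinAt.leftLim_eq

theorem tendsto_leftLim (h : RegularPath x w n r T) {t : ℝ≥0} (ht : 0 < t) :
    Tendsto w (nhdsWithin t (Iio t)) (nhds (Function.leftLim w t)) := by
  obtain ⟨l, hl⟩ := h.left_lim t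
  have : (nhdsWithin t (Iio t)).NeBot := nhdsLT_neBot_of_exists_lt ⟨0, ht⟩
  rwa [leftLim_eq_of_tendsto hl]

/-- A continuous path is bounded on [0, T]. Marks above `M` therefore never act, and the bounce
noise matters only on a strip of finite intensity. -/
theorem exists_bounceRate_le (h : RegularPath x w n r T) :
    ∃ M : ℕ, ∀ t ≤ T, bounceRate (x t) ((Function.leftLim w t : USphere d) : Euc d) ≤ M := by
  obtain ⟨C, hC⟩ := (isCompact_Icc (a := (0 : ℝ≥0)) (b := T)).exists_bound_of_continuousOn
    h.continuous_pos.continuousOn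
  obtain ⟨M, hM⟩ := exists_nat_ge C
  refine ⟨M, fun t ht => max_le ?_ (Nat.cast_nonneg M)⟩
  have h1 := real_inner_le_norm (x t) ((Function.leftLim w t : USphere d) : Euc d)
  have h2 := hC t ⟨zero_le, ht⟩
  simp only [norm_eq_of_mem_sphere, mul_one] at h1
  linarith

theorem integrableOn_bounceJump (h : RegularPath x w n r T) :
    IntegrableOn (fun p : ℝ≥0 × ℝ≥0 => bounceJump x w p.1 p.2) (Icc 0 T ×ˢ univ) n := by
  obtain ⟨M, hM⟩ := h.exists_bounceRate_le
  have h1 : IntegrableOn (fun p : ℝ≥0 × ℝ≥0 => bounceJump x w p.1 p.2)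
      (Icc 0 T ×ˢ Iic (M : ℝ≥0)) n := by
    refine IntegrableOn.of_bound (h.finite_bounce M).lt_top
      (h.pointMeasure_bounce.aestronglyMeasurable _).restrict 2 (ae_of_all _ fun p => ?_)
    unfold bounceJump
    dsimp only
    split_ifs
    · exact norm_bounce_sub_le _ _
    · simp
  refine h1.of_forall_sdiff_eq_zero (measurableSet_Icc.prod MeasurableSet.univ) ?_
  rintro ⟨t, z⟩ ⟨⟨ht, -⟩, hz⟩
  have hz' : (M : ℝ≥0) < z := by
    by_contra hcon
    exact hz ⟨ht, not_lt.1 hcon⟩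
  have hz'' : (M : ℝ) < z := by exact_mod_cast hz'
  unfold bounceJump
  dsimp only
  rw [if_neg]
  rw [h.leftLim_pos, not_le]
  exact (hM t ht.2).trans_lt hz''

theorem integrableOn_refreshJump (h : RegularPath x w n r T) :
    IntegrableOn (fun p : ℝ≥0 × USphere d =>
      (p.2 : Euc d) - ((Function.leftLim w p.1 : USphere d) : Euc d)) (Icc 0 T ×ˢ univ) r := by
  refine IntegrableOn.of_bound h.finite_refresh.lt_top
    (h.pointMeasure_refresh.aestronglyMeasurable _).restrict 2 (ae_of_all _ fun p => ?_)
  refine (norm_sub_le _ _).trans ?_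
  simp only [norm_eq_of_mem_sphere]
  norm_num

/-- When the velocity equation is taken along times increasing strictly to `t`, the part of each
integral over `{t}` is exactly what the limit loses. -/
theorem vel_sub_leftLim (h : RegularPath x w n r T) {t : ℝ≥0} (ht : t ∈ Ioc 0 T) :
    (w t : Euc d) - ((Function.leftLim w t : USphere d) : Euc d)
      = (∫ p in {t} ×ˢ univ, bounceJump x w p.1 p.2 ∂n)
        + ∫ p in {t} ×ˢ univ, ((p.2 : Euc d) - ((Function.leftLim w p.1 : USphere d) : Euc d)) ∂r := by
  obtain ⟨u, hu, hut, hlim⟩ := exists_seq_strictMono_tendsto' ht.1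
  have hsub : ∀ {Y : Type} , (Icc 0 t ×ˢ univ : Set (ℝ≥0 × Y)) ⊆ Icc 0 T ×ˢ univ :=
    fun {_} => Set.prod_mono (Icc_subset_Icc le_rfl ht.2) le_rfl
  have h1 := tendsto_setIntegral_Icc_prod hu.monotone (fun n => (hut n).2) hlim
    (h.integrableOn_bounceJump.mono_set hsub)
  have h2 := tendsto_setIntegral_Icc_prod hu.monotone (fun n => (hut n).2) hlim
    (h.integrableOn_refreshJump.mono_set hsub)
  have h3 := (h1.const_add (w 0 : Euc d)).add h2
  have h4 : Tendsto (fun n => (w (u n) : Euc d)) atTop (nhds ((Function.leftLim w t : USphere d) : Euc d)) :=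
    (continuous_subtype_val.tendsto _).comp ((h.tendsto_leftLim ht.1).comp
      (tendsto_nhdsWithin_iff.2 ⟨hlim, Eventually.of_forall fun n => (hut n).2⟩))
  have h5 := tendsto_nhds_unique (h3.congr fun n => (h.vel_eq (u n)).symm) h4
  rw [← h5, h.vel_eq t]
  abel

/-- The position is continuous, so the jump is the inner product of `x t` with the velocity jump.
All bounce points at time `t` that act contribute the same vector, which leaves their number as a
factor. -/
theorem angularMomentum_sub_leftLim (h : RegularPath x w n r T) {t : ℝ≥0} (ht : t ∈ Ioc 0 T) :
    inner ℝ (x t) (w t : Euc d) - Function.leftLim (fun s => inner ℝ (x s) (w s : Euc d)) t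
      = (n ({t} ×ˢ {z : ℝ≥0 | (z : ℝ) ≤ bounceRate (x t) ((Function.leftLim w t : USphere d) : Euc d)})).toReal
          * (-2 * inner ℝ (x t) ((Function.leftLim w t : USphere d) : Euc d))
        + inner ℝ (x t) (∫ p in {t} ×ˢ univ,
            ((p.2 : Euc d) - ((Function.leftLim w p.1 : USphere d) : Euc d)) ∂r) := by
  have : (nhdsWithin t (Iio t)).NeBot := nhdsLT_neBot_of_exists_lt ⟨0, ht.1⟩
  have h1 : Tendsto (fun s => inner ℝ (x s) (w s : Euc d)) (nhdsWithin t (Iio t))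
      (nhds (inner ℝ (x t) ((Function.leftLim w t : USphere d) : Euc d))) :=
    (h.continuous_pos.continuousAt.continuousWithinAt.tendsto).inner
      ((continuous_subtype_val.tendsto _).comp (h.tendsto_leftLim ht.1))
  rw [leftLim_eq_of_tendsto h1, ← inner_sub_right, h.vel_sub_leftLim ht, inner_add_right]
  congr 1
  set Z : Set ℝ≥0 := {z : ℝ≥0 | (z : ℝ) ≤ bounceRate (x t) ((Function.leftLim w t : USphere d) : Euc d)} with hZ
  have hZm : MeasurableSet Z := measurableSet_le NNReal.continuous_coe.measurable measurable_const
  have htm : MeasurableSet ({t} : Set ℝ≥0) := measurableSet_singleton t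
  have h2 : ∫ p in {t} ×ˢ univ, bounceJump x w p.1 p.2 ∂n
      = ∫ p in {t} ×ˢ univ, ({t} ×ˢ Z : Set (ℝ≥0 × ℝ≥0)).indicator (fun _ =>
        bounce (x t) ((Function.leftLim w t : USphere d) : Euc d) - ((Function.leftLim w t : USphere d) : Euc d)) p ∂n := by
    refine setIntegral_congr_fun (htm.prod MeasurableSet.univ) ?_
    rintro ⟨s, z⟩ ⟨hs, -⟩
    obtain rfl : s = t := hs
    by_cases hz : (z : ℝ) ≤ bounceRate (x s) ((Function.leftLim w s : USphere d) : Euc d)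
    · simp [bounceJump, h.leftLim_pos, hZ, hz]
    · simp [bounceJump, h.leftLim_pos, hZ, hz]
  rw [h2, setIntegral_indicator (htm.prod hZm), setIntegral_const, inner_smul_right,
    inner_bounce_sub, prod_inter_prod, inter_self, univ_inter, measureReal_def]

/-- At most one point of the noise acts at any time, and the angular momentum jumps exactly when
there is one. -/
theorem jump_iff (h : RegularPath x w n r T) {t : ℝ≥0} (ht : t ∈ Ioc 0 T) :
    n ({t} ×ˢ {z : ℝ≥0 | (z : ℝ) ≤ bounceRate (x t) ((Function.leftLim w t : USphere d) : Euc d)}) ≤ 1 ∧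
    r ({t} ×ˢ univ) ≤ 1 ∧
    (n ({t} ×ˢ {z : ℝ≥0 | (z : ℝ) ≤ bounceRate (x t) ((Function.leftLim w t : USphere d) : Euc d)}) = 0 ∨
      r ({t} ×ˢ univ) = 0) ∧
    (inner ℝ (x t) (w t : Euc d) - Function.leftLim (fun s => inner ℝ (x s) (w s : Euc d)) t ≠ 0 ↔
      n ({t} ×ˢ {z : ℝ≥0 | (z : ℝ) ≤ bounceRate (x t) ((Function.leftLim w t : USphere d) : Euc d)}) ≠ 0 ∨
      r ({t} ×ˢ univ) ≠ 0) := by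
  obtain ⟨M, hM⟩ := h.exists_bounceRate_le
  obtain ⟨hs1, hs2, hs3⟩ := h.simple M t ht
  rw [h.angularMomentum_sub_leftLim ht]
  set c := n ({t} ×ˢ {z : ℝ≥0 | (z : ℝ) ≤ bounceRate (x t) ((Function.leftLim w t : USphere d) : Euc d)}) with hc
  have hcle : c ≤ n ({t} ×ˢ Iic (M : ℝ≥0)) := by
    refine measure_mono (Set.prod_mono le_rfl fun z hz => ?_)
    have h1 : (z : ℝ) ≤ M := le_trans hz (hM t ht.2)
    exact_mod_cast h1
  have hc1 : c ≤ 1 := hcle.trans hs1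
  have hor : c = 0 ∨ r ({t} ×ˢ univ) = 0 := hs3.imp (fun h0 => le_antisymm (hcle.trans h0.le) zero_le) id
  refine ⟨hc1, hs2, hor, ?_⟩
  by_cases hc0 : c = 0
  · rw [hc0]
    simp only [ENNReal.toReal_zero, zero_mul, zero_add, ne_eq, not_true_eq_false, false_or]
    by_cases hr0 : r ({t} ×ˢ univ) = 0
    · rw [Measure.restrict_eq_zero.2 hr0]
      simp [hr0]
    · simp only [hr0, not_false_eq_true, iff_true]
      have htm : MeasurableSet ({t} ×ˢ univ : Set (ℝ≥0 × USphere d)) :=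
        (measurableSet_singleton t).prod MeasurableSet.univ
      obtain ⟨p, hp⟩ := (h.pointMeasure_refresh.restrict htm).exists_eq_dirac
        (by rwa [Measure.restrict_apply_univ]) (by rwa [Measure.restrict_apply_univ])
      have hpt : p.1 = t := by
        by_contra hcon
        have h1 : r.restrict ({t} ×ˢ univ) ({t} ×ˢ univ)ᶜ = 0 := by
          rw [Measure.restrict_apply htm.compl, compl_inter_self, measure_empty]
        rw [hp, Measure.dirac_apply_of_mem (by simpa using hcon)] at h1
        exact one_ne_zero h1
      rw [hp, integral_dirac]
      -- A zero jump would place `p` in the set that `h.refresh` declares null, although the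
      -- restricted measure is the unit mass at `p`.
      intro hin
      have h2 := Measure.restrict_le_self (μ := r) (s := {t} ×ˢ univ) (Ioc 0 T ×ˢ univ ∩
        {p | inner ℝ (x p.1) ((p.2 : Euc d) - ((Function.leftLim w p.1 : USphere d) : Euc d)) = 0})
      rw [h.refresh, hp, Measure.dirac_apply_of_mem] at h2
      · exact absurd h2 (by simp)
      · refine ⟨⟨by rw [hpt]; exact ht, mem_univ _⟩, ?_⟩
        simp only [mem_ofPred_eq]
        rw [← hin, hpt]
  · have hr0 : r ({t} ×ˢ univ) = 0 := hor.resolve_left hc0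
    rw [Measure.restrict_eq_zero.2 hr0]
    simp only [integral_zero_measure, inner_zero_right, add_zero, hr0, ne_eq, hc0,
      not_false_eq_true, not_true_eq_false, or_false, iff_true]
    refine mul_ne_zero (ENNReal.toReal_ne_zero.2 ⟨hc0, ne_top_of_le_ne_top ENNReal.one_ne_top hc1⟩)
      (mul_ne_zero (by norm_num) fun hin => hc0 ?_)
    -- If the inner product vanished, so would the rate. Only marks equal to 0 could act, and there
    -- are none.
    refine measure_mono_null (t := Icc 0 T ×ˢ {0}) (Set.prod_mono ?_ ?_) h.bounce_pos
    · simpa using ht.2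
    · intro z hz
      have h1 : (z : ℝ) ≤ 0 := by
        have h2 : (z : ℝ) ≤ bounceRate (x t) ((Function.leftLim w t : USphere d) : Euc d) := hz
        rwa [bounceRate, hin, max_self] at h2
      exact le_antisymm (by exact_mod_cast h1) zero_le

/-- The number of switches is the number of points of the noise that act. -/
theorem numSwitches_eq (h : RegularPath x w n r T) {A : Set (ℝ≥0 × ℝ≥0)} (hA : MeasurableSet A)
    (hA' : ∀ t ∈ Ioc 0 T, ∀ z : ℝ≥0,
      (t, z) ∈ A ↔ (z : ℝ) ≤ bounceRate (x t) ((Function.leftLim w t : USphere d) : Euc d)) :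
    numSwitches (fun t => inner ℝ (x t) (w t : Euc d)) T
      = n (Ioc 0 T ×ˢ univ ∩ A) + r (Ioc 0 T ×ˢ univ) := by
  have hW : MeasurableSet (Ioc 0 T ×ˢ univ ∩ A) := (measurableSet_Ioc.prod MeasurableSet.univ).inter hA
  have hV : MeasurableSet (Ioc 0 T ×ˢ (univ : Set (USphere d))) :=
    measurableSet_Ioc.prod MeasurableSet.univ
  have hn1 : ∀ t ∈ Ioc 0 T, n.restrict (Ioc 0 T ×ˢ univ ∩ A) ({t} ×ˢ univ)
      = n ({t} ×ˢ {z : ℝ≥0 | (z : ℝ) ≤ bounceRate (x t) ((Function.leftLim w t : USphere d) : Euc d)}) := by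
    intro t ht
    rw [Measure.restrict_apply ((measurableSet_singleton t).prod MeasurableSet.univ)]
    congr 1
    ext ⟨s, z⟩
    simp only [mem_inter_iff, mem_prod, mem_singleton_iff, mem_univ, and_true, mem_ofPred_eq]
    constructor
    · rintro ⟨rfl, hs, hz⟩
      exact ⟨rfl, (hA' s hs z).1 hz⟩
    · rintro ⟨rfl, hz⟩
      exact ⟨rfl, ht, (hA' s ht z).2 hz⟩
  have hr1 : ∀ t ∈ Ioc 0 T, r.restrict (Ioc 0 T ×ˢ univ) ({t} ×ˢ univ) = r ({t} ×ˢ univ) := by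
    intro t ht
    rw [Measure.restrict_apply ((measurableSet_singleton t).prod MeasurableSet.univ),
      inter_eq_left.2 (Set.prod_mono (by simpa using ht) le_rfl)]
  have hn0 : ∀ t ∉ Ioc 0 T, n.restrict (Ioc 0 T ×ˢ univ ∩ A) ({t} ×ˢ univ) = 0 := by
    intro t ht
    rw [Measure.restrict_apply ((measurableSet_singleton t).prod MeasurableSet.univ)]
    convert measure_empty (μ := n)
    ext ⟨s, z⟩
    simp only [mem_inter_iff, mem_prod, mem_singleton_iff, mem_univ, and_true,
      mem_empty_iff_false, iff_false]
    rintro ⟨rfl, hs, -⟩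
    exact ht hs
  have hr0 : ∀ t ∉ Ioc 0 T, r.restrict (Ioc 0 T ×ˢ univ) ({t} ×ˢ univ) = 0 := by
    intro t ht
    rw [Measure.restrict_apply ((measurableSet_singleton t).prod MeasurableSet.univ)]
    convert measure_empty (μ := r)
    ext ⟨s, z⟩
    simp only [mem_inter_iff, mem_prod, mem_singleton_iff, mem_univ, and_true,
      mem_empty_iff_false, iff_false]
    rintro ⟨rfl, hs⟩
    exact ht hs
  have hn := (h.pointMeasure_bounce.restrict hW).measure_univ_eq_encard fun t => by
    by_cases ht : t ∈ Ioc 0 T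
    · rw [hn1 t ht]
      exact (h.jump_iff ht).1
    · simp [hn0 t ht]
  have hr := (h.pointMeasure_refresh.restrict hV).measure_univ_eq_encard fun t => by
    by_cases ht : t ∈ Ioc 0 T
    · rw [hr1 t ht]
      exact (h.jump_iff ht).2.1
    · simp [hr0 t ht]
  rw [Measure.restrict_apply_univ] at hn hr
  -- The times of bounces and of refreshments are disjoint, so the two counts add up to the
  -- cardinality of the union.
  rw [hn, hr, ← ENat.toENNReal_add, ← encard_union_eq, numSwitches]
  · congr 2
    ext t
    simp only [mem_ofPred_eq, mem_union]
    by_cases ht : t ∈ Ioc 0 T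
    · rw [hn1 t ht, hr1 t ht, ← (h.jump_iff ht).2.2.2]
      simp [ht.2]
    · simp only [hn0 t ht, hr0 t ht, ne_eq, not_true_eq_false, or_self, iff_false, not_and, not_not]
      intro htT
      have ht0 : t = 0 := by
        by_contra hcon
        exact ht ⟨pos_iff_ne_zero.2 hcon, htT⟩
      subst ht0
      -- There are no times before 0, so `Function.leftLim` returns the value itself there and time
      -- 0 is never a switch.
      rw [leftLim_eq_of_eq_bot, sub_self]
      simp
  · refine disjoint_left.2 fun t ht ht' => ?_
    simp only [mem_ofPred_eq] at ht ht'
    by_cases hT : t ∈ Ioc 0 T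
    · rw [hn1 t hT] at ht
      rw [hr1 t hT] at ht'
      exact (h.jump_iff hT).2.2.1.elim ht ht'
    · exact ht (hn0 t hT)

end RegularPath

end Paths

/-! ### The stationary sampler: left limits and Campbell's formula -/

noncomputable section Sampler

variable {Ω : Type*} {mΩ : MeasurableSpace Ω} {P : Measure Ω} {d : ℕ} {ρ : ℝ≥0} {F : Filtration ℝ≥0 mΩ} {N : Ω → Measure (ℝ≥0 × ℝ≥0)}
  {R : Ω → Measure (ℝ≥0 × USphere d)} {ξ : ℝ≥0 → Ω → Euc d} {v : ℝ≥0 → Ω → USphere d}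

theorem IsStationaryFromTarget.map_eq {Ω : Type*} {mΩ : MeasurableSpace Ω} {P : Measure Ω}
    {ξ : ℝ≥0 → Ω → Euc d} {v : ℝ≥0 → Ω → USphere d}
    (h : IsStationaryFromTarget P ξ v) (t : ℝ≥0) :
    P.map (fun ω => (ξ t ω, v t ω)) = bpsTarget d := by
  have h1 := ((h.shift_law t).comp (measurable_pi_apply (0 : ℝ≥0))).map_eq
  rw [← h.initial_law]
  simpa [Function.comp_def] using h1

instance : PolishSpace (USphere d) := Metric.isClosed_sphere.polishSpace

/-- The left version of the sampler. -/
abbrev leftState [Nonempty (USphere d)] (ξ : ℝ≥0 → Ω → Euc d) (v : ℝ≥0 → Ω → USphere d) :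
    ℝ≥0 → Ω → Euc d × USphere d :=
  leftVersion fun t ω => (ξ t ω, v t ω)

namespace IsBPS

theorem ae_continuous (h : IsBPS P d ρ F N R ξ v) : ∀ᵐ ω ∂P, Continuous fun t => ξ t ω := by
  filter_upwards [h.pos_eq] with ω hω
  exact continuous_of_eq_add_integral (measurable_of_rightContinuous (h.right_cont ω)) hω

theorem ae_tendsto (h : IsBPS P d ρ F N R ξ v) : ∀ᵐ ω ∂P, ∀ t : ℝ≥0, 0 < t →
    Tendsto (fun s => (ξ s ω, v s ω)) (nhdsWithin t (Iio t))
      (nhds (ξ t ω, Function.leftLim (fun s => v s ω) t)) := by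
  filter_upwards [h.ae_continuous] with ω hω t ht
  have : (nhdsWithin t (Iio t)).NeBot := nhdsLT_neBot_of_exists_lt ⟨0, ht⟩
  obtain ⟨l, hl⟩ := h.left_lim ω t
  rw [leftLim_eq_of_tendsto hl]
  exact (hω.continuousAt.continuousWithinAt.tendsto).prodMk_nhds hl

theorem adapted_state (h : IsBPS P d ρ F N R ξ v) : Adapted F fun t ω => (ξ t ω, v t ω) :=
  fun t => Measurable.prodMk (h.adapted_pos t) (h.adapted_vel t)

theorem measurable_leftState [Nonempty (USphere d)] (h : IsBPS P d ρ F N R ξ v) :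
    Measurable[F.predictable] fun p : ℝ≥0 × Ω => leftState ξ v p.1 p.2 :=
  measurable_predictable_leftVersion h.adapted_state

theorem map_leftState [IsProbabilityMeasure P] [Nonempty (USphere d)] (h : IsBPS P d ρ F N R ξ v)
    (hstat : IsStationaryFromTarget P ξ v) {s : ℝ≥0} (hs : 0 < s) :
    P.map (leftState ξ v s) = bpsTarget d := by
  refine map_leftVersion h.adapted_state hstat.map_eq hs ?_
  filter_upwards [h.ae_tendsto] with ω hω
  exact ⟨_, hω s hs⟩

theorem lintegral_leftState [IsProbabilityMeasure P] [Nonempty (USphere d)] (h : IsBPS P d ρ F N R ξ v)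
    (hstat : IsStationaryFromTarget P ξ v) {s : ℝ≥0} (hs : 0 < s)
    {f : Euc d × USphere d → ℝ≥0∞} (hf : Measurable f) :
    ∫⁻ ω, f (leftState ξ v s ω) ∂P = ∫⁻ x, f x ∂(bpsTarget d) := by
  have hm : Measurable (leftState ξ v s) := by
    have hjoint : Measurable fun p : ℝ≥0 × Ω => leftState ξ v p.1 p.2 := fun B hB =>
      predictable_le_prod F _ (h.measurable_leftState hB)
    exact hjoint.of_uncurry_left
  rw [← h.map_leftState hstat hs, lintegral_map hf hm]

/-- The points of the bounce noise that cause a bounce. -/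
def activeSet [Nonempty (USphere d)] (ξ : ℝ≥0 → Ω → Euc d) (v : ℝ≥0 → Ω → USphere d) :
    Set ((ℝ≥0 × Ω) × ℝ≥0) :=
  {p | (p.2 : ℝ) ≤ bounceRate (leftState ξ v p.1.1 p.1.2).1 ((leftState ξ v p.1.1 p.1.2).2 : Euc d)}

/-- The refreshments that leave the angular momentum unchanged. -/
def nullRefreshSet [Nonempty (USphere d)] (ξ : ℝ≥0 → Ω → Euc d) (v : ℝ≥0 → Ω → USphere d) :
    Set ((ℝ≥0 × Ω) × USphere d) :=
  {p | inner ℝ (leftState ξ v p.1.1 p.1.2).1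
    ((p.2 : Euc d) - ((leftState ξ v p.1.1 p.1.2).2 : Euc d)) = 0}

theorem measurableSet_activeSet [Nonempty (USphere d)] (h : IsBPS P d ρ F N R ξ v) :
    MeasurableSet[predictableMarked F ℝ≥0] (activeSet ξ v) := by
  have h1 : Measurable[predictableMarked F ℝ≥0] fun p : (ℝ≥0 × Ω) × ℝ≥0 =>
      (leftState ξ v p.1.1 p.1.2, p.2) :=
    letI := F.predictable
    (h.measurable_leftState.comp measurable_fst).prodMk measurable_snd
  have h2 : MeasurableSet {q : (Euc d × USphere d) × ℝ≥0 |
      (q.2 : ℝ) ≤ bounceRate q.1.1 (q.1.2 : Euc d)} := by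
    refine measurableSet_le (by fun_prop) ?_
    unfold bounceRate
    fun_prop
  exact h1 h2

theorem measurableSet_nullRefreshSet [Nonempty (USphere d)] (h : IsBPS P d ρ F N R ξ v) :
    MeasurableSet[predictableMarked F (USphere d)] (nullRefreshSet ξ v) := by
  have h1 : Measurable[predictableMarked F (USphere d)] fun p : (ℝ≥0 × Ω) × USphere d =>
      (leftState ξ v p.1.1 p.1.2, p.2) :=
    letI := F.predictable
    (h.measurable_leftState.comp measurable_fst).prodMk measurable_snd
  have h2 : MeasurableSet {q : (Euc d × USphere d) × USphere d |
      inner ℝ q.1.1 ((q.2 : Euc d) - (q.1.2 : Euc d)) = 0} := by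
    refine measurableSet_eq_fun ?_ measurable_const
    fun_prop
  exact h1 h2

theorem indep_futureNoise_bounce (h : IsBPS P d ρ F N R ξ v) (t : ℝ≥0) :
    Indep (F t) (futureNoise N t) P :=
  indep_of_indep_of_le_right (h.indep_future t) le_sup_left

theorem indep_futureNoise_refresh (h : IsBPS P d ρ F N R ξ v) (t : ℝ≥0) :
    Indep (F t) (futureNoise R t) P :=
  indep_of_indep_of_le_right (h.indep_future t) le_sup_right

theorem lebesgueNN_le_bounceRate (x : Euc d) (w : USphere d) :
    lebesgueNN {z : ℝ≥0 | (z : ℝ) ≤ bounceRate x (w : Euc d)}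
      = ENNReal.ofReal (bounceRate x (w : Euc d)) := by
  have h0 : 0 ≤ bounceRate x (w : Euc d) := le_max_right _ _
  have h1 : {z : ℝ≥0 | (z : ℝ) ≤ bounceRate x (w : Euc d)}
      = Icc 0 (bounceRate x (w : Euc d)).toNNReal := by
    ext z
    simp [Real.le_toNNReal_iff_coe_le h0]
  rw [h1, lebesgueNN_Icc_zero]
  rfl

/-- The expected number of bounces up to time `T`. -/
theorem lintegral_bounces [IsProbabilityMeasure P] [Nonempty (USphere d)] (h : IsBPS P d ρ F N R ξ v)
    (hstat : IsStationaryFromTarget P ξ v) (hd : 2 ≤ d) (T : ℝ≥0) :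
    AEMeasurable (fun ω => N ω (Ioc 0 T ×ˢ univ ∩ pathSection (activeSet ξ v) ω)) P ∧
    ∫⁻ ω, N ω (Ioc 0 T ×ˢ univ ∩ pathSection (activeSet ξ v) ω) ∂P
      = T * ENNReal.ofReal (1 / Real.sqrt (2 * Real.pi)) := by
  obtain ⟨h1, h2⟩ := campbell lebesgueNN h.poisson_bounce h.indep_futureNoise_bounce T
    h.measurableSet_activeSet
  refine ⟨h1, ?_⟩
  rw [h2]
  have h3 : ∀ s ∈ Ioc 0 T, ∫⁻ ω, lebesgueNN {y | ((s, ω), y) ∈ activeSet ξ v} ∂P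
      = ENNReal.ofReal (1 / Real.sqrt (2 * Real.pi)) := by
    intro s hs
    have hm : Measurable fun x : Euc d × USphere d =>
        ENNReal.ofReal (bounceRate x.1 (x.2 : Euc d)) := by
      unfold bounceRate
      fun_prop
    have h4 : ∀ ω, lebesgueNN {y | ((s, ω), y) ∈ activeSet ξ v}
        = ENNReal.ofReal (bounceRate (leftState ξ v s ω).1 ((leftState ξ v s ω).2 : Euc d)) :=
      fun ω => lebesgueNN_le_bounceRate (leftState ξ v s ω).1 (leftState ξ v s ω).2
    rw [lintegral_congr h4, ← lintegral_bounceRate_bpsTarget hd]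
    exact h.lintegral_leftState hstat hs.1 hm
  rw [setLIntegral_congr_fun measurableSet_Ioc h3, setLIntegral_const, lebesgueNN_Ioc, mul_comm]
  simp

/-- Almost surely every refreshment changes the angular momentum. -/
theorem ae_nullRefreshSet [IsProbabilityMeasure P] [Nonempty (USphere d)] (h : IsBPS P d ρ F N R ξ v)
    (hstat : IsStationaryFromTarget P ξ v) (hd : 2 ≤ d) (T : ℝ≥0) :
    ∀ᵐ ω ∂P, R ω (Ioc 0 T ×ˢ univ ∩ pathSection (nullRefreshSet ξ v) ω) = 0 := by
  have := isProbabilityMeasure_sphereUniform hd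
  have : IsFiniteMeasure ((ρ : ℝ≥0∞) • sphereUniform d) :=
    (sphereUniform d).smul_finite ENNReal.coe_ne_top
  obtain ⟨h1, h2⟩ := campbell ((ρ : ℝ≥0∞) • sphereUniform d) h.poisson_refresh
    h.indep_futureNoise_refresh T h.measurableSet_nullRefreshSet
  have h3 : ∀ s ∈ Ioc 0 T, ∫⁻ ω, ((ρ : ℝ≥0∞) • sphereUniform d)
      {y | ((s, ω), y) ∈ nullRefreshSet ξ v} ∂P = 0 := by
    intro s hs
    have hm : Measurable fun x : Euc d × USphere d =>
        sphereUniform d {u | inner ℝ x.1 ((u : Euc d) - (x.2 : Euc d)) = 0} := by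
      have hm : MeasurableSet {p : (Euc d × USphere d) × USphere d |
          inner ℝ p.1.1 ((p.2 : Euc d) - (p.1.2 : Euc d)) = 0} := by
        refine measurableSet_eq_fun ?_ measurable_const
        fun_prop
      exact measurable_measure_prodMk_left (ν := sphereUniform d) hm
    have h4 := h.lintegral_leftState hstat hs.1 hm
    rw [lintegral_refresh_null hd] at h4
    simp only [Measure.smul_apply, smul_eq_mul]
    rw [lintegral_const_mul' _ _ ENNReal.coe_ne_top]
    exact mul_eq_zero_of_right _ h4
  rw [setLIntegral_congr_fun measurableSet_Ioc h3, lintegral_zero] at h2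
  exact (lintegral_eq_zero_iff' h1).1 h2

theorem ae_leftState_eq [Nonempty (USphere d)] (h : IsBPS P d ρ F N R ξ v) :
    ∀ᵐ ω ∂P, ∀ t : ℝ≥0, 0 < t →
      leftState ξ v t ω = (ξ t ω, Function.leftLim (fun s => v s ω) t) := by
  filter_upwards [h.ae_tendsto] with ω hω t ht
  exact leftVersion_eq_leftLim ht (hω t ht)

/-- Each requirement is almost sure, and those indexed by a mark bound range over natural numbers,
so they hold together. From here on the counting of switches is deterministic. -/
theorem ae_regularPath [IsProbabilityMeasure P] [Nonempty (USphere d)] (h : IsBPS P d ρ F N R ξ v)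
    (hstat : IsStationaryFromTarget P ξ v) (hd : 2 ≤ d) (T : ℝ≥0) :
    ∀ᵐ ω ∂P, RegularPath (fun t => ξ t ω) (fun t => v t ω) (N ω) (R ω) T := by
  have := isProbabilityMeasure_sphereUniform hd
  have : IsFiniteMeasure ((ρ : ℝ≥0∞) • sphereUniform d) :=
    (sphereUniform d).smul_finite ENNReal.coe_ne_top
  have hIic : ∀ M : ℕ, lebesgueNN (Iic (M : ℝ≥0)) ≠ ∞ := by
    intro M
    rw [← Icc_bot, bot_eq_zero', lebesgueNN_Icc_zero]
    exact ENNReal.coe_ne_top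
  have hfinN : ∀ᵐ ω ∂P, ∀ M : ℕ, N ω (Icc 0 T ×ˢ Iic (M : ℝ≥0)) ≠ ∞ := by
    refine ae_all_iff.2 fun M =>
      h.poisson_bounce.ae_ne_top (measurableSet_Icc.prod measurableSet_Iic) ?_
    rw [Measure.prod_prod, lebesgueNN_Icc_zero]
    exact ENNReal.mul_ne_top ENNReal.coe_ne_top (hIic M)
  have hfinR : ∀ᵐ ω ∂P, R ω (Icc 0 T ×ˢ univ) ≠ ∞ := by
    refine h.poisson_refresh.ae_ne_top (measurableSet_Icc.prod MeasurableSet.univ) ?_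
    rw [Measure.prod_prod, lebesgueNN_Icc_zero]
    exact ENNReal.mul_ne_top ENNReal.coe_ne_top (measure_ne_top _ _)
  have hzero : ∀ᵐ ω ∂P, N ω (Icc 0 T ×ˢ {0}) = 0 := by
    refine h.poisson_bounce.ae_eq_zero (measurableSet_Icc.prod (measurableSet_singleton 0)) ?_
    rw [Measure.prod_prod, lebesgueNN_singleton, mul_zero]
  have hsimple := ae_all_iff.2 fun M : ℕ => ae_no_simultaneous_points h.poisson_bounce
    h.poisson_refresh h.indep_noise measurableSet_Iic (hIic M) MeasurableSet.univ
    (measure_ne_top _ _) T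
  filter_upwards [h.poisson_bounce.isPointMeasure, h.poisson_refresh.isPointMeasure,
    h.ae_continuous, h.vel_eq, hfinN, hfinR, hzero, hsimple, h.ae_nullRefreshSet hstat hd T,
    h.ae_leftState_eq] with ω h1 h2 h3 h4 h5 h6 h7 h8 h9 h10
  refine ⟨h1, h2, h3, h.left_lim ω, h4, h5, h6, h7, h8, ?_⟩
  refine measure_mono_null
    (t := Ioc 0 T ×ˢ univ ∩ pathSection (nullRefreshSet ξ v) ω) (fun p hp => ⟨hp.1, ?_⟩) h9
  change inner ℝ (leftState ξ v p.1 ω).1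
    ((p.2 : Euc d) - ((leftState ξ v p.1 ω).2 : Euc d)) = 0
  rw [h10 p.1 hp.1.1.1]
  exact hp.2

end IsBPS

end Sampler

/-! ### The expected number of switches -/

theorem mainTheorem9 {Ω : Type*} {mΩ : MeasurableSpace Ω} (P : Measure Ω) [IsProbabilityMeasure P]
    (d : ℕ) (hd : 2 ≤ d) (ρ : ℝ≥0) (hρ : 0 < ρ)
    (F : Filtration ℝ≥0 mΩ) (N : Ω → Measure (ℝ≥0 × ℝ≥0)) (R : Ω → Measure (ℝ≥0 × USphere d))
    (ξ : ℝ≥0 → Ω → Euc d) (v : ℝ≥0 → Ω → USphere d)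
    (hBPS : IsBPS P d ρ F N R ξ v) (hstat : IsStationaryFromTarget P ξ v) (T : ℝ≥0) :
    AEMeasurable (fun ω => numSwitches (fun t => angularMomentum ξ v t ω) T) P ∧
    ∫⁻ ω, numSwitches (fun t => angularMomentum ξ v t ω) T ∂P
      = ENNReal.ofReal (T * (1 / Real.sqrt (2 * Real.pi) + ρ)) := by
  obtain ⟨ω₀⟩ : Nonempty Ω := nonempty_of_isProbabilityMeasure P
  have : Nonempty (USphere d) := ⟨v 0 ω₀⟩
  have := isProbabilityMeasure_sphereUniform hd
  have : IsFiniteMeasure ((ρ : ℝ≥0∞) • sphereUniform d) :=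
    (sphereUniform d).smul_finite ENNReal.coe_ne_top
  obtain ⟨hm, hi⟩ := hBPS.lintegral_bounces hstat hd T
  have hW : MeasurableSet (Ioc 0 T ×ˢ (univ : Set (USphere d))) :=
    measurableSet_Ioc.prod MeasurableSet.univ
  have hint : lebesgueNN.prod ((ρ : ℝ≥0∞) • sphereUniform d) (Ioc 0 T ×ˢ univ) = T * ρ := by
    rw [Measure.prod_prod, lebesgueNN_Ioc]
    simp
  have heq : (fun ω => numSwitches (fun t => angularMomentum ξ v t ω) T) =ᵐ[P] fun ω =>
      N ω (Ioc 0 T ×ˢ univ ∩ pathSection (IsBPS.activeSet ξ v) ω) + R ω (Ioc 0 T ×ˢ univ) := by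
    filter_upwards [hBPS.ae_regularPath hstat hd T, hBPS.ae_leftState_eq] with ω h1 h2
    refine h1.numSwitches_eq (measurableSet_pathSection
      (predictableMarked_le F _ hBPS.measurableSet_activeSet) ω) fun t ht z => ?_
    -- Outside one null set the predictable version equals the true left limits at all positive
    -- times at once, so the predictable active set selects exactly the marks that act.
    change (z : ℝ) ≤ bounceRate (leftState ξ v t ω).1 ((leftState ξ v t ω).2 : Euc d) ↔ _
    rw [h2 t ht.1]
  have hmR := hBPS.poisson_refresh.measurable_apply hW
  refine ⟨(hm.add hmR.aemeasurable).congr heq.symm, ?_⟩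
  rw [lintegral_congr_ae heq, lintegral_add_right _ hmR, hi,
    hBPS.poisson_refresh.lintegral_apply hW (by rw [hint]; finiteness), hint, ← mul_add,
    ENNReal.ofReal_mul (NNReal.coe_nonneg T), ENNReal.ofReal_add (by positivity)
      (NNReal.coe_nonneg ρ)]
  simp
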